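/- \textbf{Setting.} Let $N\in\mathbb N$, let $\mathbb X_1,\dots,\mathbb X_N,\mathbb Y$ be compact Polish spaces with finite Borel reference measures $\lambda_1,\dots,\lambda_N,\lambda_{\mathbb Y}$ (for instance finite sets with counting measure, or compact subsets of $\mathbb R^d$ with Lebesgue measure), and put $\mathbb X=\prod_{i=1}^N\mathbb X_i$. All products carry the product reference measures. $\mathcal M^+(Z)$ is the set of finite non-negative Borel measures on $Z$. For $\pi\in\mathcal M^+(Z)$ and the reference measure $\lambda$ on $Z$, the entropy is $E(\pi)=\int_Z\log\frac{d\pi}{d\lambda}\,d\pi\in(-\infty,\infty]$ if $\pi\ll\lambda$, and $E(\pi)=\infty$ otherwise. An entropy function is a convex lower semicontinuous $\varphi:\mathbb R\to[0,\infty]$ with $\varphi(1)=0$ and $\varphi=\infty$ on $(-\infty,0)$; its recession constant is $\varphi'_\infty=\lim_{x\to\infty}\varphi(x)/x$. For finite measures with Lebesgue decomposition $\mu=\sigma_\mu\nu+\mu^\perp$, put $D_\varphi(\mu,\nu)=\int\varphi\circ\sigma_\mu\,d\nu+\varphi'_\infty\,\mu^\perp(Z)$, with $0\cdot\infty=0$.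 Let $\iota_S$ be $0$ on $S$ and $\infty$ outside $S$. Put $\psi=\iota_{\{1\}}$ (so that $D_\psi(\cdot,\xi)=\iota_{\{\xi\}}$) and $\varphi_{N+1}=\iota_{[0,\infty)}$ (so that $D_{\varphi_{N+1}}=0$). Let $\varepsilon>0$, $t_i\ge0$ with $\sum_{i=1}^N t_i=1$, $\mu_i\in\mathcal M^+(\mathbb X_i)$, $\mu_{N+1}\in\mathcal M^+(\mathbb Y)$, $c_i\in C(\mathbb X_i\times\mathbb Y)$, entropy functions $\varphi_i$ ($i=1,\dots,N$), and $c_t(x,y)=\sum_{i=1}^N t_ic_i(x_i,y)$. Writing $\pi_i$ and $P_{\mathbb Y\#}\pi$ for marginals, define, for $\eta>0$ and $\xi\in\mathcal M^+(\mathbb Y)$, $$\mathrm{UOT}_{\eta}^{(c_i,\varphi_i,\psi)}(\mu_i,\xi)=\inf_{\pi\in\mathcal M^+(\mathbb X_i\times\mathbb Y)}\int c_i\,d\pi+\eta E(\pi)+D_{\varphi_i}(P_{\mathbb X_i\#}\pi,\mu_i)+D_\psi(P_{\mathbb Y\#}\pi,\xi),$$ $$\mathrm{UMOT}_\varepsilon^{(c_t,t\varphi)}(\mu,\mu_{N+1})=\inf_{\pi\in\mathcal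 M^+(\mathbb X\times\mathbb Y)}\int c_t\,d\pi+\varepsilon E(\pi)+\sum_{i=1}^N D_{t_i\varphi_i}(\pi_i,\mu_i)+D_{\varphi_{N+1}}(P_{\mathbb Y\#}\pi,\mu_{N+1}),$$ $$F(\xi)=\sum_{i=1}^N t_i\,\mathrm{UOT}_{\varepsilon/t_i}^{(c_i,\varphi_i,\psi)}(\mu_i,\xi)-\varepsilon(N-1)E(\xi),$$ where $F(\xi)=\infty$ if $E(\xi)=\infty$ (convention $\infty-\infty=\infty$), and where a term with $t_i=0$ means $\inf\{\varepsilon E(\pi):\pi\in\mathcal M^+(\mathbb X_i\times\mathbb Y),\ P_{\mathbb Y\#}\pi=\xi\}$. \textbf{Theorem.} Suppose that $\sum_{i=1}^N(\varphi_i)'_\infty+\inf c_t>0$. Then $$\inf_{\xi\in\mathcal M^+(\mathbb Y)}F(\xi)=\mathrm{UMOT}_\varepsilon^{(c_t,t\varphi)}(\mu,\mu_{N+1}).$$ Moreover, if this common value is finite, then the problem defining $\mathrm{UMOT}_\varepsilon^{(c_t,t\varphi)}(\mu,\mu_{N+1})$ has a unique optimal plan $\hat\pi$, the functional $F$ has a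 unique minimizer $\hat\xi$ on $\mathcal M^+(\mathbb Y)$, and $P_{\mathbb Y\#}\hat\pi=\hat\xi$. -/

import Mathlib

open MeasureTheory
open scoped ENNReal NNReal

noncomputable section

namespace UnbalancedOT

/-- An entropy function: a non-negative, convex, lower semicontinuous function on `ℝ` with values
in `[0, ∞]`, vanishing at `1` (hence proper) and equal to `∞` on the negative half-line. -/
structure IsEntropyFunction (φ : ℝ → ℝ≥0∞) : Prop where
  convex : ConvexOn ℝ≥0 Set.univ φ
  lsc : LowerSemicontinuous φ
  map_one : φ 1 = 0
  map_neg : ∀ x : ℝ, x < 0 → φ x = ∞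

/-- The indicator function of convex analysis: `0` on `S` and `∞` outside `S`. -/
def convexIndicator (S : Set ℝ) : ℝ → ℝ≥0∞ := by
  classical exact fun x => if x ∈ S then 0 else ∞

/-- The recession constant `lim_{x → ∞} φ x / x`. (For an entropy function the limit exists in
`[0, ∞]`, so that it is equal to the upper limit.) -/
def recession (φ : ℝ → ℝ≥0∞) : ℝ≥0∞ :=
  Filter.limsup (fun x : ℝ => φ x / ENNReal.ofReal x) Filter.atTop

/-- The `φ`-divergence `∫ φ ∘ σ dν + φ'_∞ μ^⊥(Z)`, where `μ = σ ν + μ^⊥` is the Lebesgue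
decomposition of `μ` with respect to `ν`, and `0 · ∞ = 0`. -/
def phiDiv {Z : Type*} [MeasurableSpace Z] (φ : ℝ → ℝ≥0∞) (μ ν : Measure Z) : ℝ≥0∞ :=
  (∫⁻ z, φ (μ.rnDeriv ν z).toReal ∂ν) + recession φ * μ.singularPart ν Set.univ

open Classical in
/-- The entropy `E(π) = ∫ log σ dπ ∈ (-∞, ∞]` of a finite measure `π` with density
`σ = dπ/dlam` with respect to the finite reference measure `lam`; it is `∞` if `π` is not
absolutely continuous. As `s log s` is bounded below and `lam` is finite, the negative part of the
integral is finite, so that non-integrability means that the integral is `∞`. -/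
def entropy {Z : Type*} [MeasurableSpace Z] (lam π : Measure Z) : EReal :=
  if π ≪ lam ∧ Integrable (fun z => Real.log (π.rnDeriv lam z).toReal) π then
    ((∫ z, Real.log (π.rnDeriv lam z).toReal ∂π : ℝ) : EReal)
  else ⊤

section Two

variable {X Y : Type*} [MeasurableSpace X] [MeasurableSpace Y]

/-- The functional minimized in entropically regularized unbalanced optimal transport between `μ`
and `ξ`, with entropy functions `φ`, `ψ` for the two marginals. -/
def uotObjective (lamX : Measure X) (lamY : Measure Y) (ε : ℝ) (c : X × Y → ℝ)
    (φ ψ : ℝ → ℝ≥0∞) (μ : FiniteMeasure X) (ξ : FiniteMeasure Y)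
    (π : FiniteMeasure (X × Y)) : EReal :=
  ((∫ z, c z ∂(π : Measure (X × Y)) : ℝ) : EReal)
    + (ε : EReal) * entropy (lamX.prod lamY) (π : Measure (X × Y))
    + ((phiDiv φ ((π : Measure (X × Y)).map Prod.fst) (μ : Measure X)
        + phiDiv ψ ((π : Measure (X × Y)).map Prod.snd) (ξ : Measure Y) : ℝ≥0∞) : EReal)

/-- The value `UOT_ε^{(c,φ,ψ)}(μ, ξ)`. -/
def UOT (lamX : Measure X) (lamY : Measure Y) (ε : ℝ) (c : X × Y → ℝ)
    (φ ψ : ℝ → ℝ≥0∞) (μ : FiniteMeasure X) (ξ : FiniteMeasure Y) : EReal :=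
  ⨅ π : FiniteMeasure (X × Y), uotObjective lamX lamY ε c φ ψ μ ξ π

/-- The weighted term `t * UOT_{ε/t}^{(c,φ,ψ)}(μ, ξ)` of the barycenter problem. It is the infimum
over `π` of `∫ t c dπ + ε E(π) + t D_φ(π_X, μ) + D_ψ(π_Y, ξ)` for `ψ = ι_{1}`, and this is what it
means for `t = 0`: there are no cost and no penalty on the first marginal. -/
def weightedUOT (lamX : Measure X) (lamY : Measure Y) (ε t : ℝ) (c : X × Y → ℝ)
    (φ ψ : ℝ → ℝ≥0∞) (μ : FiniteMeasure X) (ξ : FiniteMeasure Y) : EReal :=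
  if t = 0 then UOT lamX lamY ε (fun _ => 0) (convexIndicator (Set.Ici 0)) ψ μ ξ
  else (t : EReal) * UOT lamX lamY (ε / t) c φ ψ μ ξ

end Two

section Multi

variable {N : ℕ} {X : Fin N → Type*} {Y : Type*}

/-- The star-shaped tree cost `c_t(x, y) = ∑ i, t i * c i (x i, y)`. -/
def starCost (t : Fin N → ℝ) (c : ∀ i, X i × Y → ℝ) : (∀ i, X i) × Y → ℝ :=
  fun z => ∑ i, t i * c i (z.1 i, z.2)

variable [∀ i, MeasurableSpace (X i)] [MeasurableSpace Y]

/-- The functional minimized in entropically regularized unbalanced multi-marginal optimal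
transport with the `N + 1` marginal spaces `X 0, …, X (N - 1), Y`. -/
def umotObjective (lam : ∀ i, Measure (X i)) (lamY : Measure Y) (ε : ℝ)
    (c : (∀ i, X i) × Y → ℝ) (φ : Fin N → ℝ → ℝ≥0∞) (φY : ℝ → ℝ≥0∞)
    (μ : ∀ i, FiniteMeasure (X i)) (μY : FiniteMeasure Y)
    (π : FiniteMeasure ((∀ i, X i) × Y)) : EReal :=
  ((∫ z, c z ∂(π : Measure ((∀ i, X i) × Y)) : ℝ) : EReal)
    + (ε : EReal) * entropy ((Measure.pi lam).prod lamY) (π : Measure ((∀ i, X i) × Y))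
    + ((∑ i, phiDiv (φ i) ((π : Measure ((∀ i, X i) × Y)).map (fun z => z.1 i))
          (μ i : Measure (X i))
        + phiDiv φY ((π : Measure ((∀ i, X i) × Y)).map Prod.snd) (μY : Measure Y) : ℝ≥0∞) :
          EReal)

/-- The value `UMOT_ε^{(c,φ,φY)}(μ, μY)`. -/
def UMOT (lam : ∀ i, Measure (X i)) (lamY : Measure Y) (ε : ℝ)
    (c : (∀ i, X i) × Y → ℝ) (φ : Fin N → ℝ → ℝ≥0∞) (φY : ℝ → ℝ≥0∞)
    (μ : ∀ i, FiniteMeasure (X i)) (μY : FiniteMeasure Y) : EReal :=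
  ⨅ π : FiniteMeasure ((∀ i, X i) × Y), umotObjective lam lamY ε c φ φY μ μY π

open Classical in
/-- The modified barycenter functional
`ξ ↦ ∑ i, t i * UOT_{ε / t i}^{(c i, φ i, ψ)}(μ i, ξ) - ε (N - 1) E(ξ)` with `ψ = ι_{1}`.
Where `E(ξ) = ∞` the transport terms are infinite too, and the value is `∞` (that is,
`∞ - ∞ = ∞` here, whereas `EReal` has `⊤ - ⊤ = ⊥`). -/
def baryObjective (lam : ∀ i, Measure (X i)) (lamY : Measure Y) (ε : ℝ) (t : Fin N → ℝ)
    (c : ∀ i, X i × Y → ℝ) (φ : Fin N → ℝ → ℝ≥0∞) (μ : ∀ i, FiniteMeasure (X i))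
    (ξ : FiniteMeasure Y) : EReal :=
  if entropy lamY (ξ : Measure Y) = ⊤ then ⊤
  else ∑ i, weightedUOT (lam i) lamY ε (t i) (c i) (φ i) (convexIndicator {1}) (μ i) ξ
    - ((ε * ((N : ℝ) - 1) : ℝ) : EReal) * entropy lamY (ξ : Measure Y)

end Multi

end UnbalancedOT

end

/-! Write J for the multi-marginal functional and F for the barycenter functional. The cost is
star-shaped, so cost and penalties of a plan depend only on its N pair marginals on `X i × Y`; only
the entropy sees more. Among plans with pair marginals π_i, all with the same Y-marginal ξ, the
entropy is at least ∑ E(π_i) - (N - 1) E(ξ), with equality for the gluing that makes the x_i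
conditionally independent given y. Its density is ∏ f_i / g^(N - 1), with f_i and g the densities of
π_i and ξ. The inequality is Gibbs' inequality against this density (`sum_integral_llr_le`); the
equality is `entropy_glue`.

The inequality gives F(P_Y π) ≤ J(π) (`baryObjective_le`). The equality turns near-optimal pair
plans over ξ into a plan over ξ whose J-value is below any prescribed number above F(ξ)
(`exists_regObjective_lt`). Hence the infima agree.

Existence and uniqueness rest on uniform convexity rather than weak compactness. The midpoint
convexity gap of the entropy dominates a squared Hellinger distance, and the superlinear growth of
the entropy bounds the mass, so near-minimizers of J are uniformly close in total variation. A
minimizing sequence is therefore Cauchy in L¹, and Fatou's lemma along a fast subsequence makes its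
limit π̂ a minimizer, to which all near-minimizers are close (`exists_minimizer`). This stability
yields both uniqueness claims: a minimizer ξ of F is the Y-marginal of plans with J arbitrarily
close to the minimum, which forces ξ = P_Y π̂. Optimal pair plans are never needed. -/

namespace UnbalancedOT

open Filter Topology InformationTheory

/-! ### Summable total variation convergence. -/

section SummablyClose

variable {Z W : Type*} [MeasurableSpace Z] [MeasurableSpace W]

/-- A sequence of measures converging to `π` in total variation at a summable rate. -/
def SummablyClose (πn : ℕ → Measure Z) (π : Measure Z) : Prop :=
  ∃ σ : ℕ → Measure Z, ∑' n, σ n Set.univ ≠ ∞ ∧ ∀ n, πn n ≤ π + σ n ∧ π ≤ πn n + σ n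

lemma SummablyClose.map {πn : ℕ → Measure Z} {π : Measure Z} (h : SummablyClose πn π)
    {p : Z → W} (hp : Measurable p) : SummablyClose (fun n => (πn n).map p) (π.map p) := by
  obtain ⟨σ, hσ, hle⟩ := h
  refine ⟨fun n => (σ n).map p, by simpa [Measure.map_apply hp MeasurableSet.univ] using hσ,
    fun n => ⟨?_, ?_⟩⟩
  · rw [← Measure.map_add _ _ hp]
    exact Measure.map_mono (hle n).1 hp
  · rw [← Measure.map_add _ _ hp]
    exact Measure.map_mono (hle n).2 hp

/-- Since a ≤ b + s, the measure b + s splits as (b + s - a) + a, and densities are additive. -/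
lemma rnDeriv_le_of_le_add {a b s ν : Measure Z} [IsFiniteMeasure a] [IsFiniteMeasure b]
    [IsFiniteMeasure s] [IsFiniteMeasure ν] (h : a ≤ b + s) :
    ∀ᵐ z ∂ν, a.rnDeriv ν z ≤ b.rnDeriv ν z + s.rnDeriv ν z := by
  have h1 := Measure.rnDeriv_add (b + s - a) a ν
  rw [Measure.sub_add_cancel_of_le h] at h1
  filter_upwards [h1, Measure.rnDeriv_add b s ν] with z h1 h2
  rw [Pi.add_apply] at h1 h2
  rw [← h2, h1]
  exact le_add_self

lemma singularPart_le_of_le_add {a b s ν : Measure Z} [IsFiniteMeasure a] [IsFiniteMeasure b]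
    [IsFiniteMeasure s] [IsFiniteMeasure ν] (h : a ≤ b + s) :
    a.singularPart ν ≤ b.singularPart ν + s := by
  have h1 := Measure.singularPart_add (b + s - a) a ν
  rw [Measure.sub_add_cancel_of_le h, Measure.singularPart_add] at h1
  calc a.singularPart ν ≤ b.singularPart ν + s.singularPart ν := by
        rw [h1]; exact Measure.le_add_left le_rfl
    _ ≤ _ := by gcongr; exact Measure.singularPart_le _ _

lemma tendsto_of_le_add {u s : ℕ → ℝ≥0∞} {a : ℝ≥0∞} (ha : a ≠ ∞)
    (hs : Tendsto s atTop (𝓝 0)) (h1 : ∀ n, u n ≤ a + s n) (h2 : ∀ n, a ≤ u n + s n) :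
    Tendsto u atTop (𝓝 a) := by
  refine tendsto_of_tendsto_of_tendsto_of_le_of_le (g := fun n => a - s n) (h := fun n => a + s n)
    ?_ ?_ (fun n => tsub_le_iff_right.2 (h2 n)) h1
  · simpa using ENNReal.Tendsto.sub (tendsto_const_nhds (x := a)) hs (Or.inl ha)
  · simpa using (tendsto_const_nhds (x := a)).add hs

/-- This is what the summable rate is for: the densities of the error measures have a sum of finite
integral, so that sum is finite a.e. and its terms tend to 0 a.e. -/
lemma SummablyClose.ae_tendsto_rnDeriv {πn : ℕ → Measure Z} {π ν : Measure Z}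
    [∀ n, IsFiniteMeasure (πn n)] [IsFiniteMeasure π] [IsFiniteMeasure ν]
    (h : SummablyClose πn π) :
    ∀ᵐ z ∂ν, Tendsto (fun n => ((πn n).rnDeriv ν z).toReal) atTop
      (𝓝 (π.rnDeriv ν z).toReal) := by
  obtain ⟨σ, hσ, hle⟩ := h
  have hfin : ∀ n, IsFiniteMeasure (σ n) := fun n =>
    ⟨(ENNReal.ne_top_of_tsum_ne_top hσ n).lt_top⟩
  have hsum : ∫⁻ z, ∑' n, (σ n).rnDeriv ν z ∂ν ≠ ∞ := by
    rw [lintegral_tsum fun n => (Measure.measurable_rnDeriv _ _).aemeasurable]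
    refine ne_top_of_le_ne_top hσ (ENNReal.tsum_le_tsum fun n => Measure.lintegral_rnDeriv_le)
  have h1 : ∀ᵐ z ∂ν, ∑' n, (σ n).rnDeriv ν z < ∞ :=
    ae_lt_top (Measurable.tsum fun n => Measure.measurable_rnDeriv _ _) hsum
  have h2 := ae_all_iff.2 fun n => rnDeriv_le_of_le_add (ν := ν) (hle n).1
  have h3 := ae_all_iff.2 fun n => rnDeriv_le_of_le_add (ν := ν) (hle n).2
  filter_upwards [h1, h2, h3, Measure.rnDeriv_lt_top π ν] with z h1 h2 h3 h4
  exact (ENNReal.tendsto_toReal h4.ne).comp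
    (tendsto_of_le_add h4.ne (ENNReal.tendsto_atTop_zero_of_tsum_ne_top h1.ne) h2 h3)

lemma SummablyClose.tendsto_singularPart {πn : ℕ → Measure Z} {π ν : Measure Z}
    [∀ n, IsFiniteMeasure (πn n)] [IsFiniteMeasure π] [IsFiniteMeasure ν]
    (h : SummablyClose πn π) :
    Tendsto (fun n => (πn n).singularPart ν Set.univ) atTop
      (𝓝 (π.singularPart ν Set.univ)) := by
  obtain ⟨σ, hσ, hle⟩ := h
  have hfin : ∀ n, IsFiniteMeasure (σ n) := fun n =>
    ⟨(ENNReal.ne_top_of_tsum_ne_top hσ n).lt_top⟩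
  exact tendsto_of_le_add (measure_ne_top _ _) (ENNReal.tendsto_atTop_zero_of_tsum_ne_top hσ)
    (fun n => singularPart_le_of_le_add (hle n).1 _)
    (fun n => singularPart_le_of_le_add (hle n).2 _)

/-! ### Midpoints and convex lower semicontinuous functionals. -/

/-- The arithmetic mean of two measures. -/
noncomputable def midpointMeasure (π π' : Measure Z) : Measure Z := (2⁻¹ : ℝ≥0) • (π + π')

instance (π π' : Measure Z) [IsFiniteMeasure π] [IsFiniteMeasure π'] :
    IsFiniteMeasure (midpointMeasure π π') := by
  unfold midpointMeasure; infer_instance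

lemma midpointMeasure_map (π π' : Measure Z) {p : Z → W} (hp : Measurable p) :
    (midpointMeasure π π').map p = midpointMeasure (π.map p) (π'.map p) := by
  simp [midpointMeasure, Measure.map_smul, Measure.map_add _ _ hp]

lemma ae_rnDeriv_midpointMeasure (π π' ν : Measure Z) [IsFiniteMeasure π] [IsFiniteMeasure π']
    [IsFiniteMeasure ν] :
    ∀ᵐ z ∂ν, ((midpointMeasure π π').rnDeriv ν z).toReal
      = ((π.rnDeriv ν z).toReal + (π'.rnDeriv ν z).toReal) / 2 := by
  filter_upwards [Measure.rnDeriv_smul_left (π + π') ν (2⁻¹ : ℝ≥0), Measure.rnDeriv_add π π' ν,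
    Measure.rnDeriv_lt_top π ν, Measure.rnDeriv_lt_top π' ν] with z h1 h2 h3 h4
  rw [midpointMeasure, h1, Pi.smul_apply, h2, Pi.add_apply, ENNReal.smul_def, smul_eq_mul,
    ENNReal.toReal_mul, ENNReal.toReal_add h3.ne h4.ne]
  simp
  ring

/-- Midpoint convexity together with lower semicontinuity under summable convergence in total
variation, for functionals of finite measures. -/
structure IsConvexLSC (D : Measure Z → ℝ≥0∞) : Prop where
  midpoint : ∀ (π π' : Measure Z) [IsFiniteMeasure π] [IsFiniteMeasure π'],
    2 * D (midpointMeasure π π') ≤ D π + D π'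
  lsc : ∀ (πn : ℕ → Measure Z) (π : Measure Z) [∀ n, IsFiniteMeasure (πn n)] [IsFiniteMeasure π],
    SummablyClose πn π → D π ≤ liminf (fun n => D (πn n)) atTop

lemma ennreal_le_liminf_add (u v : ℕ → ℝ≥0∞) :
    liminf u atTop + liminf v atTop ≤ liminf (fun n => u n + v n) atTop := by
  simp only [liminf_eq_iSup_iInf_of_nat]
  rw [ENNReal.iSup_add_iSup_of_monotone]
  · refine iSup_mono fun n => le_iInf₂ fun i hi => add_le_add ?_ ?_
    · exact iInf₂_le i hi
    · exact iInf₂_le i hi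
  · exact fun a b hab => le_iInf₂ fun i hi => iInf₂_le i (hab.trans hi)
  · exact fun a b hab => le_iInf₂ fun i hi => iInf₂_le i (hab.trans hi)

lemma IsConvexLSC.zero : IsConvexLSC (fun _ : Measure Z => 0) := ⟨by simp, by simp⟩

lemma IsConvexLSC.add {D D' : Measure Z → ℝ≥0∞} (h : IsConvexLSC D) (h' : IsConvexLSC D') :
    IsConvexLSC (fun π => D π + D' π) where
  midpoint π π' _ _ := by
    calc _ = 2 * D (midpointMeasure π π') + 2 * D' (midpointMeasure π π') := mul_add _ _ _
      _ ≤ (D π + D π') + (D' π + D' π') := add_le_add (h.midpoint π π') (h'.midpoint π π')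
      _ = _ := by ring
  lsc πn π _ _ hc := (add_le_add (h.lsc πn π hc) (h'.lsc πn π hc)).trans
    (ennreal_le_liminf_add _ _)

lemma IsConvexLSC.sum {ι : Type*} (s : Finset ι) {D : ι → Measure Z → ℝ≥0∞}
    (h : ∀ i, IsConvexLSC (D i)) : IsConvexLSC (fun π => ∑ i ∈ s, D i π) := by
  classical
  induction s using Finset.induction_on with
  | empty => simpa using IsConvexLSC.zero
  | insert i s hi ih => simpa [Finset.sum_insert hi] using (h i).add ih

lemma IsConvexLSC.comp_map {D : Measure W → ℝ≥0∞} (h : IsConvexLSC D) {p : Z → W}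
    (hp : Measurable p) : IsConvexLSC (fun π : Measure Z => D (π.map p)) where
  midpoint π π' _ _ := by
    rw [midpointMeasure_map π π' hp]
    exact h.midpoint _ _
  lsc πn π _ _ hc := h.lsc _ _ (hc.map hp)

lemma two_mul_lintegral_midpoint_le {φ : ℝ → ℝ≥0∞} (hm : Measurable φ)
    (hφ : ∀ a b : ℝ, 0 ≤ a → 0 ≤ b → 2 * φ ((a + b) / 2) ≤ φ a + φ b)
    (π π' ν : Measure Z) [IsFiniteMeasure π] [IsFiniteMeasure π'] [IsFiniteMeasure ν] :
    2 * ∫⁻ z, φ ((midpointMeasure π π').rnDeriv ν z).toReal ∂ν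
      ≤ ∫⁻ z, φ (π.rnDeriv ν z).toReal ∂ν + ∫⁻ z, φ (π'.rnDeriv ν z).toReal ∂ν := by
  rw [← lintegral_const_mul _ (by fun_prop), ← lintegral_add_left (by fun_prop)]
  refine lintegral_mono_ae ?_
  filter_upwards [ae_rnDeriv_midpointMeasure π π' ν] with z hz
  rw [hz]
  exact hφ _ _ ENNReal.toReal_nonneg ENNReal.toReal_nonneg

/-- Fatou's lemma, applied to the a.e. convergence of the densities. -/
lemma SummablyClose.lintegral_le_liminf {φ : ℝ → ℝ≥0∞} (hφ : LowerSemicontinuous φ)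
    {πn : ℕ → Measure Z} {π ν : Measure Z}
    [∀ n, IsFiniteMeasure (πn n)] [IsFiniteMeasure π] [IsFiniteMeasure ν]
    (h : SummablyClose πn π) :
    ∫⁻ z, φ (π.rnDeriv ν z).toReal ∂ν
      ≤ liminf (fun n => ∫⁻ z, φ ((πn n).rnDeriv ν z).toReal ∂ν) atTop := by
  have hm : Measurable φ := hφ.measurable
  refine le_trans (lintegral_mono_ae ?_) (lintegral_liminf_le fun n => by fun_prop)
  filter_upwards [h.ae_tendsto_rnDeriv (ν := ν)] with z hz
  refine (LowerSemicontinuousAt.le_liminf (hφ _)).trans ?_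
  exact liminf_le_liminf_of_le hz

lemma IsEntropyFunction.midpoint {φ : ℝ → ℝ≥0∞} (hφ : IsEntropyFunction φ) (a b : ℝ) :
    2 * φ ((a + b) / 2) ≤ φ a + φ b := by
  have h := hφ.convex.2 (Set.mem_univ a) (Set.mem_univ b) (zero_le : 0 ≤ (2⁻¹ : ℝ≥0))
    (zero_le : 0 ≤ (2⁻¹ : ℝ≥0)) (by rw [← two_mul]; exact mul_inv_cancel₀ two_ne_zero)
  have e : (2⁻¹ : ℝ≥0) • a + (2⁻¹ : ℝ≥0) • b = (a + b) / 2 := by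
    simp only [NNReal.smul_def, smul_eq_mul]; push_cast; ring
  rw [e, ← smul_add, ENNReal.smul_def, smul_eq_mul] at h
  calc 2 * φ ((a + b) / 2) ≤ 2 * (((2⁻¹ : ℝ≥0) : ℝ≥0∞) * (φ a + φ b)) := by gcongr
    _ = _ := by
      rw [← mul_assoc, ENNReal.coe_inv (by norm_num)]
      simp [ENNReal.mul_inv_cancel]

/-- The `φ`-divergence is midpoint convex and lower semicontinuous in its first argument. -/
lemma isConvexLSC_phiDiv {φ : ℝ → ℝ≥0∞} (hφ : IsEntropyFunction φ) (ν : Measure Z)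
    [IsFiniteMeasure ν] : IsConvexLSC (fun π => phiDiv φ π ν) where
  midpoint π π' _ _ := by
    have h1 := two_mul_lintegral_midpoint_le hφ.lsc.measurable (fun a b _ _ => hφ.midpoint a b)
      π π' ν
    have h2 : 2 * (midpointMeasure π π').singularPart ν Set.univ
        = π.singularPart ν Set.univ + π'.singularPart ν Set.univ := by
      rw [midpointMeasure, Measure.singularPart_smul, Measure.singularPart_add,
        Measure.smul_apply, ENNReal.smul_def, smul_eq_mul, ← mul_assoc,
        ENNReal.coe_inv (by norm_num)]
      simp [ENNReal.mul_inv_cancel]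
    calc 2 * phiDiv φ (midpointMeasure π π') ν
        = 2 * (∫⁻ z, φ ((midpointMeasure π π').rnDeriv ν z).toReal ∂ν)
          + recession φ * (2 * (midpointMeasure π π').singularPart ν Set.univ) := by
          unfold phiDiv; ring
      _ ≤ _ := by
          rw [h2]
          refine (add_le_add h1 le_rfl).trans_eq ?_
          unfold phiDiv; ring
  lsc πn π _ _ hc := by
    refine le_trans (add_le_add (hc.lintegral_le_liminf hφ.lsc) ?_) (ennreal_le_liminf_add _ _)
    -- The recession constant may be ∞, and multiplication by ∞ is not continuous at 0; but for
    -- limit mass 0 the term to be bounded is 0.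
    by_cases h0 : π.singularPart ν Set.univ = 0
    · simp [h0]
    · exact (ENNReal.Tendsto.const_mul hc.tendsto_singularPart (Or.inl h0)).liminf_eq.ge

lemma recession_const_mul {φ : ℝ → ℝ≥0∞} {a : ℝ≥0∞} (ha : a ≠ ∞) :
    recession (fun x => a * φ x) = a * recession φ := by
  simp only [recession, mul_div_assoc]
  exact ENNReal.limsup_const_mul_of_ne_top ha

lemma phiDiv_const_mul {φ : ℝ → ℝ≥0∞} {a : ℝ≥0∞} (ha : a ≠ ∞) (π ν : Measure Z) :
    phiDiv (fun x => a * φ x) π ν = a * phiDiv φ π ν := by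
  rw [phiDiv, recession_const_mul ha, lintegral_const_mul' _ _ ha, phiDiv]
  ring

lemma IsConvexLSC.const_mul {D : Measure Z → ℝ≥0∞} (h : IsConvexLSC D) {a : ℝ≥0∞} (ha : a ≠ ∞) :
    IsConvexLSC (fun π => a * D π) where
  midpoint π π' _ _ := by
    calc 2 * (a * D (midpointMeasure π π')) = a * (2 * D (midpointMeasure π π')) := by ring
      _ ≤ a * (D π + D π') := by gcongr; exact h.midpoint π π'
      _ = _ := by ring
  lsc πn π _ _ hc := by
    rw [ENNReal.liminf_const_mul_of_ne_top ha]
    gcongr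
    exact h.lsc πn π hc

lemma phiDiv_convexIndicator_Ici (π ν : Measure Z) :
    phiDiv (convexIndicator (Set.Ici 0)) π ν = 0 := by
  have h : recession (convexIndicator (Set.Ici 0)) = 0 := by
    rw [recession, limsup_congr (v := fun _ => 0)]
    · simp
    · filter_upwards [eventually_ge_atTop 0] with x hx
      simp [convexIndicator, hx]
  simp [phiDiv, h, convexIndicator]

-- The recession constant is ∞, so a finite value excludes a singular part, and finiteness of the
-- integral forces the density to be 1 a.e.
open Classical in
lemma phiDiv_convexIndicator_one (π ν : Measure Z) [IsFiniteMeasure π] [IsFiniteMeasure ν] :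
    phiDiv (convexIndicator {1}) π ν = if π = ν then 0 else ∞ := by
  have hrec : recession (convexIndicator {1}) = ∞ := by
    rw [recession, limsup_congr (v := fun _ => ∞)]
    · simp
    · filter_upwards [eventually_gt_atTop 1] with x hx
      simp [convexIndicator, hx.ne', ENNReal.top_div]
  split_ifs with h
  · subst h
    have h1 : ∫⁻ z, convexIndicator {1} (π.rnDeriv π z).toReal ∂π = 0 := by
      rw [lintegral_congr_ae (g := fun _ => 0)]
      · simp
      · filter_upwards [π.rnDeriv_self] with z hz
        simp [hz, convexIndicator]
    simp [phiDiv, h1, Measure.singularPart_self]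
  · by_contra hne
    rw [phiDiv, hrec, ENNReal.add_eq_top, not_or] at hne
    have h1 : π.singularPart ν = 0 := by
      by_contra h0
      exact hne.2 (ENNReal.top_mul (by simpa using h0))
    have hmeas : Measurable fun z => convexIndicator {1} (π.rnDeriv ν z).toReal := by
      unfold convexIndicator
      exact Measurable.ite ((measurableSet_singleton _).preimage (by fun_prop)) measurable_const
        measurable_const
    have h2 : π.rnDeriv ν =ᵐ[ν] 1 := by
      filter_upwards [ae_lt_top hmeas hne.1] with z hz
      by_contra h3
      have : (π.rnDeriv ν z).toReal ≠ 1 := fun h4 => h3 (by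
        simpa using (ENNReal.toReal_eq_one_iff _).1 h4)
      simp [convexIndicator, this] at hz
    apply h
    rw [π.haveLebesgueDecomposition_add ν, h1, withDensity_congr_ae h2]
    simp

end SummablyClose

/-! ### Uniform convexity and growth of the entropy. -/

section Entropy

variable {Z : Type*} [MeasurableSpace Z]

/-- This is log x ≤ x - 1 at x = √m / √a, multiplied by 2a. -/
lemma two_sub_two_sqrt_le_log {a m : ℝ} (ha : 0 ≤ a) (hm : 0 < m) :
    2 * a - 2 * (√a * √m) ≤ a * Real.log a - a * Real.log m := by
  rcases ha.eq_or_lt with rfl | ha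
  · simp
  have hsa := Real.sqrt_pos.2 ha
  have h := Real.log_le_sub_one_of_pos (div_pos (Real.sqrt_pos.2 hm) hsa)
  rw [Real.log_div (Real.sqrt_pos.2 hm).ne' hsa.ne', Real.log_sqrt hm.le, Real.log_sqrt ha.le] at h
  have h2 := mul_le_mul_of_nonneg_left h ha.le
  have h3 : a * (√m / √a - 1) = √a * √m - a := by
    calc a * (√m / √a - 1) = √a * √a * (√m / √a) - a := by rw [Real.mul_self_sqrt ha.le]; ring
      _ = √a * √m - a := by field_simp
  rw [h3] at h2
  linarith

/-- Uniform midpoint convexity of the integrand of the Kullback-Leibler divergence. -/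
lemma klFun_midpoint_add_le {a b : ℝ} (ha : 0 ≤ a) (hb : 0 ≤ b) :
    2 * klFun ((a + b) / 2) + (√a - √b) ^ 2 / 2 ≤ klFun a + klFun b := by
  rcases (add_nonneg ha hb).eq_or_lt with h0 | h0
  · have ha0 : a = 0 := by linarith
    have hb0 : b = 0 := by linarith
    subst ha0 hb0
    simp [klFun]
    norm_num
  set m := (a + b) / 2 with hm
  have hmpos : 0 < m := by positivity
  have h1 := two_sub_two_sqrt_le_log ha hmpos
  have h2 := two_sub_two_sqrt_le_log hb hmpos
  have e1 := Real.sq_sqrt ha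
  have e2 := Real.sq_sqrt hb
  have e3 := Real.sq_sqrt hmpos.le
  have h3 : 2 * m * Real.log m = a * Real.log m + b * Real.log m := by rw [hm]; ring
  simp only [klFun]
  -- The affine terms of `klFun` cancel. With s = √a + √b and d = √a - √b one has 4m = 2(a + b) = s²
  -- + d², and 2 s √m ≤ (s² + 4m) / 2 leaves exactly d² / 2.
  nlinarith [sq_nonneg (√a + √b - 2 * √m)]

/-- Factor a - b = (√a - √b)(√a + √b) and apply Young's inequality with weight δ. The free δ lets
the mass term be made small before the Hellinger term. -/
lemma abs_sub_le_hellinger {a b δ : ℝ} (ha : 0 ≤ a) (hb : 0 ≤ b) (hδ : 0 < δ) :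
    |a - b| ≤ δ⁻¹ * ((√a - √b) ^ 2 / 2) + δ * (a + b) := by
  have e1 := Real.sq_sqrt ha
  have e2 := Real.sq_sqrt hb
  have h1 : |a - b| = |√a - √b| * (√a + √b) := by
    rw [← abs_of_nonneg (add_nonneg (Real.sqrt_nonneg a) (Real.sqrt_nonneg b)), ← abs_mul]
    congr 1
    nlinarith
  rw [h1, ← sq_abs (√a - √b)]
  set d := |√a - √b|
  set s := √a + √b with hs
  have h2 : s ^ 2 ≤ 2 * (a + b) := by rw [hs]; nlinarith [sq_nonneg (√a - √b)]
  have h3 : δ * (d * s) ≤ d ^ 2 / 2 + δ ^ 2 * (a + b) := by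
    nlinarith [sq_nonneg (d - δ * s), sq_nonneg δ]
  rw [← mul_le_mul_iff_right₀ hδ]
  calc δ * (d * s) ≤ d ^ 2 / 2 + δ ^ 2 * (a + b) := h3
    _ = _ := by field_simp

/-- Fenchel-Young inequality: exp R - 1 is the convex conjugate of `klFun` at R. -/
lemma mul_le_klFun_add_exp (R : ℝ) {s : ℝ} (hs : 0 ≤ s) : R * s ≤ klFun s + (Real.exp R - 1) := by
  rcases hs.eq_or_lt with rfl | hs
  · simp [klFun, (Real.exp_pos R).le]
  have h := Real.add_one_le_exp (R - Real.log s)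
  rw [Real.exp_sub, Real.exp_log hs] at h
  have h2 := mul_le_mul_of_nonneg_left h hs.le
  rw [mul_div_cancel₀ _ hs.ne'] at h2
  simp only [klFun]
  nlinarith

/-- Half of the squared Hellinger distance of the densities with respect to `lam`. -/
noncomputable def hellinger (lam π π' : Measure Z) : ℝ≥0∞ :=
  ∫⁻ z, ENNReal.ofReal ((√(π.rnDeriv lam z).toReal - √(π'.rnDeriv lam z).toReal) ^ 2 / 2) ∂lam

/-- The `L¹` distance of the densities with respect to `lam`. -/
noncomputable def densityDist (lam π π' : Measure Z) : ℝ≥0∞ :=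
  ∫⁻ z, ENNReal.ofReal |(π.rnDeriv lam z).toReal - (π'.rnDeriv lam z).toReal| ∂lam

lemma densityDist_comm (lam π π' : Measure Z) :
    densityDist lam π π' = densityDist lam π' π := by
  simp only [densityDist, abs_sub_comm]

lemma densityDist_le (lam π π' : Measure Z) {δ : ℝ} (hδ : 0 < δ) :
    densityDist lam π π' ≤ ENNReal.ofReal δ⁻¹ * hellinger lam π π'
      + ENNReal.ofReal δ * (π Set.univ + π' Set.univ) := by
  calc densityDist lam π π'
      ≤ ∫⁻ z, (ENNReal.ofReal δ⁻¹ * ENNReal.ofReal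
            ((√(π.rnDeriv lam z).toReal - √(π'.rnDeriv lam z).toReal) ^ 2 / 2)
          + ENNReal.ofReal δ * (π.rnDeriv lam z + π'.rnDeriv lam z)) ∂lam := by
        refine lintegral_mono fun z => ?_
        refine (ENNReal.ofReal_le_ofReal (abs_sub_le_hellinger ENNReal.toReal_nonneg
          ENNReal.toReal_nonneg hδ)).trans ?_
        rw [ENNReal.ofReal_add (by positivity) (by positivity),
          ENNReal.ofReal_mul (by positivity), ENNReal.ofReal_mul hδ.le,
          ENNReal.ofReal_add (by positivity) (by positivity)]
        gcongr <;> exact ENNReal.ofReal_toReal_le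
    _ = ENNReal.ofReal δ⁻¹ * hellinger lam π π'
        + ENNReal.ofReal δ * (∫⁻ z, π.rnDeriv lam z ∂lam + ∫⁻ z, π'.rnDeriv lam z ∂lam) := by
        rw [lintegral_add_left (by fun_prop), lintegral_const_mul _ (by fun_prop),
          lintegral_const_mul _ (by fun_prop), lintegral_add_left (by fun_prop), hellinger]
    _ ≤ _ := by gcongr <;> exact Measure.lintegral_rnDeriv_le

/-- Supplies the error measures of `SummablyClose`: their total mass is the L¹ distance of the
densities. Only the dominated measure has to be absolutely continuous. -/
lemma le_add_withDensity_abs_sub {lam π : Measure Z} (π' : Measure Z) [IsFiniteMeasure lam]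
    [IsFiniteMeasure π] [IsFiniteMeasure π'] (h : π ≪ lam) :
    π ≤ π' + lam.withDensity fun z =>
      ENNReal.ofReal |(π.rnDeriv lam z).toReal - (π'.rnDeriv lam z).toReal| := by
  calc π = lam.withDensity (π.rnDeriv lam) := (Measure.withDensity_rnDeriv_eq π lam h).symm
    _ ≤ lam.withDensity (π'.rnDeriv lam + fun z =>
      ENNReal.ofReal |(π.rnDeriv lam z).toReal - (π'.rnDeriv lam z).toReal|) := by
        refine withDensity_mono ?_
        filter_upwards [π.rnDeriv_lt_top lam, π'.rnDeriv_lt_top lam] with z h1 h2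
        calc π.rnDeriv lam z = ENNReal.ofReal (π.rnDeriv lam z).toReal :=
              (ENNReal.ofReal_toReal h1.ne).symm
          _ ≤ ENNReal.ofReal ((π'.rnDeriv lam z).toReal
              + |(π.rnDeriv lam z).toReal - (π'.rnDeriv lam z).toReal|) :=
              ENNReal.ofReal_le_ofReal (by
                linarith [le_abs_self ((π.rnDeriv lam z).toReal - (π'.rnDeriv lam z).toReal)])
          _ = _ := by
              rw [ENNReal.ofReal_add ENNReal.toReal_nonneg (abs_nonneg _),
                ENNReal.ofReal_toReal h2.ne, Pi.add_apply]
    _ = lam.withDensity (π'.rnDeriv lam) + _ := withDensity_add_left (by fun_prop) _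
    _ ≤ _ := by gcongr; exact Measure.withDensity_rnDeriv_le _ _

lemma abs_measureReal_sub_le_of_densityDist_le {lam π π' : Measure Z} [IsFiniteMeasure lam]
    [IsFiniteMeasure π] [IsFiniteMeasure π'] (h : π ≪ lam) (h' : π' ≪ lam) {τ : ℝ} (hτ : 0 ≤ τ)
    (hd : densityDist lam π π' ≤ ENNReal.ofReal τ) (A : Set Z) :
    |π.real A - π'.real A| ≤ τ := by
  have key : ∀ (ρ ρ' : Measure Z) [IsFiniteMeasure ρ] [IsFiniteMeasure ρ'], ρ ≪ lam →
      densityDist lam ρ ρ' ≤ ENNReal.ofReal τ → ρ.real A ≤ ρ'.real A + τ := by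
    intro ρ ρ' _ _ hρ hd
    have h1 : ρ A ≤ ρ' A + ENNReal.ofReal τ := by
      refine (le_add_withDensity_abs_sub ρ' hρ A).trans ?_
      rw [Measure.add_apply]
      gcongr
      refine (measure_mono (Set.subset_univ A)).trans (le_trans ?_ hd)
      rw [withDensity_apply _ MeasurableSet.univ, setLIntegral_univ, densityDist]
    have h2 := ENNReal.toReal_mono (by simp) h1
    rwa [ENNReal.toReal_add (by simp) (by simp), ENNReal.toReal_ofReal hτ] at h2
  rw [abs_sub_le_iff]
  constructor
  · linarith [key π π' h hd]
  · linarith [key π' π h' (densityDist_comm lam π π' ▸ hd)]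

lemma two_mul_klDiv_midpoint_add_hellinger_le (lam π π' : Measure Z) [IsFiniteMeasure lam]
    [IsFiniteMeasure π] [IsFiniteMeasure π'] :
    2 * klDiv (midpointMeasure π π') lam + hellinger lam π π' ≤ klDiv π lam + klDiv π' lam := by
  by_cases h : π ≪ lam
  swap; · simp [klDiv_of_not_ac h]
  by_cases h' : π' ≪ lam
  swap; · simp [klDiv_of_not_ac h']
  have hm : midpointMeasure π π' ≪ lam := (h.add_left h').smul_left _
  rw [klDiv_eq_lintegral_klFun_of_ac h, klDiv_eq_lintegral_klFun_of_ac h',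
    klDiv_eq_lintegral_klFun_of_ac hm, hellinger, ← lintegral_const_mul _ (by fun_prop),
    ← lintegral_add_left (by fun_prop), ← lintegral_add_left (by fun_prop)]
  refine lintegral_mono_ae ?_
  filter_upwards [ae_rnDeriv_midpointMeasure π π' lam] with z hz
  rw [hz]
  set a := (π.rnDeriv lam z).toReal
  set b := (π'.rnDeriv lam z).toReal
  have ha : 0 ≤ a := ENNReal.toReal_nonneg
  have hb : 0 ≤ b := ENNReal.toReal_nonneg
  have hab : 0 ≤ klFun ((a + b) / 2) := klFun_nonneg (by positivity)
  rw [← ENNReal.ofReal_add (klFun_nonneg ha) (klFun_nonneg hb),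
    show (2 : ℝ≥0∞) = ENNReal.ofReal 2 by simp, ← ENNReal.ofReal_mul (by norm_num),
    ← ENNReal.ofReal_add (by positivity) (by positivity)]
  exact ENNReal.ofReal_le_ofReal (klFun_midpoint_add_le ha hb)

/-- Fatou for the `klFun` integrals. Absolute continuity of the limit is assumed because without it
`klDiv` is ∞ while the `klFun` integral may be finite. -/
lemma SummablyClose.klDiv_le_liminf {lam π : Measure Z} {πn : ℕ → Measure Z} [IsFiniteMeasure lam]
    [∀ n, IsFiniteMeasure (πn n)] [IsFiniteMeasure π] (h : SummablyClose πn π) (hπ : π ≪ lam) :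
    klDiv π lam ≤ liminf (fun n => klDiv (πn n) lam) atTop := by
  have hl : LowerSemicontinuous fun x : ℝ => ENNReal.ofReal (klFun x) :=
    (ENNReal.continuous_ofReal.comp continuous_klFun).lowerSemicontinuous
  rw [klDiv_eq_lintegral_klFun_of_ac hπ]
  refine (h.lintegral_le_liminf (ν := lam) hl).trans (liminf_le_liminf (.of_forall fun n => ?_))
  rw [klDiv_eq_lintegral_klFun]
  split_ifs
  · exact le_rfl
  · exact le_top

/-- The arbitrary slope R expresses superlinear growth; it is later chosen to beat a bounded cost.
-/
lemma mul_measureReal_le_klDiv (lam π : Measure Z) [IsFiniteMeasure lam] [IsFiniteMeasure π]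
    (h : klDiv π lam ≠ ∞) (R : ℝ) :
    R * π.real Set.univ ≤ (klDiv π lam).toReal + (Real.exp R - 1) * lam.real Set.univ := by
  obtain ⟨hac, hint⟩ := klDiv_ne_top_iff.1 h
  have hkl : Integrable (fun z => klFun (π.rnDeriv lam z).toReal) lam :=
    (integrable_klFun_rnDeriv_iff hac).2 hint
  rw [toReal_klDiv_eq_integral_klFun hac, ← Measure.integral_toReal_rnDeriv hac,
    ← integral_const_mul, mul_comm (Real.exp R - 1), ← smul_eq_mul, ← integral_const,
    ← integral_add hkl (integrable_const _)]
  exact integral_mono (Measure.integrable_toReal_rnDeriv.const_mul R)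
    (hkl.add (integrable_const _)) fun z => mul_le_klFun_add_exp R ENNReal.toReal_nonneg

lemma entropy_ne_top_iff {lam π : Measure Z} :
    entropy lam π ≠ ⊤ ↔ π ≪ lam ∧ Integrable (llr π lam) π := by
  unfold entropy
  split_ifs with h
  · exact ⟨fun _ => h, fun _ => EReal.coe_ne_top _⟩
  · exact ⟨fun h' => absurd rfl h', fun h' => absurd h' h⟩

lemma entropy_eq_coe {lam π : Measure Z} (h : entropy lam π ≠ ⊤) :
    entropy lam π = ((∫ z, llr π lam z ∂π : ℝ) : EReal) :=
  if_pos (entropy_ne_top_iff.1 h)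

lemma entropy_ne_top_iff_klDiv {lam π : Measure Z} :
    entropy lam π ≠ ⊤ ↔ klDiv π lam ≠ ∞ := by
  rw [entropy_ne_top_iff, klDiv_ne_top_iff]

/-- `klDiv` carries a mass correction that makes it nonnegative; the discrepancy is affine in π and
so does not affect convexity arguments. -/
lemma entropy_eq_klDiv {lam π : Measure Z} [IsFiniteMeasure lam] [IsFiniteMeasure π] :
    entropy lam π = ((π.real Set.univ - lam.real Set.univ : ℝ) : EReal)
      + ((klDiv π lam : ℝ≥0∞) : EReal) := by
  by_cases h : klDiv π lam = ∞
  · rw [h, EReal.coe_ennreal_top, EReal.coe_add_top]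
    by_contra h'
    exact entropy_ne_top_iff_klDiv.1 h' h
  · obtain ⟨hac, hint⟩ := klDiv_ne_top_iff.1 h
    rw [entropy_eq_coe (entropy_ne_top_iff_klDiv.2 h), ← EReal.coe_ennreal_toReal h,
      toReal_klDiv hac hint, ← EReal.coe_add]
    congr 1
    ring

end Entropy

/-! ### The direct method by uniform convexity. -/

section DirectMethod

variable {Z : Type*} [MeasurableSpace Z]

/-- Entropically regularized minimization of a linear cost and a penalty `D`. -/
noncomputable def regObjective (lam : Measure Z) (ε : ℝ) (c : Z → ℝ) (D : Measure Z → ℝ≥0∞)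
    (π : Measure Z) : EReal :=
  ((∫ z, c z ∂π : ℝ) : EReal) + (ε : EReal) * entropy lam π + ((D π : ℝ≥0∞) : EReal)

/-- The affine part of the regularized objective. -/
noncomputable def affinePart (lam : Measure Z) (ε : ℝ) (c : Z → ℝ) (π : Measure Z) : ℝ :=
  ∫ z, c z ∂π + ε * (π.real Set.univ - lam.real Set.univ)

/-- The nonnegative part of the regularized objective. -/
noncomputable def convexPart (lam : Measure Z) (ε : ℝ) (D : Measure Z → ℝ≥0∞)
    (π : Measure Z) : ℝ≥0∞ :=
  ENNReal.ofReal ε * klDiv π lam + D π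

/-- The real value of the regularized objective, where it is finite. -/
noncomputable def realObjective (lam : Measure Z) (ε : ℝ) (c : Z → ℝ) (D : Measure Z → ℝ≥0∞)
    (π : Measure Z) : ℝ :=
  affinePart lam ε c π + (convexPart lam ε D π).toReal

variable {lam : Measure Z} {ε : ℝ} {c : Z → ℝ} {D : Measure Z → ℝ≥0∞} {C : ℝ}

lemma klDiv_ne_top_of_convexPart (hε : 0 < ε) {π : Measure Z} (h : convexPart lam ε D π ≠ ∞) :
    klDiv π lam ≠ ∞ := by
  intro h'
  refine h ?_
  rw [convexPart, h', ENNReal.mul_top (by simpa using hε), top_add]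

lemma integrable_of_abs_le (hc : Measurable c) (hC : ∀ z, |c z| ≤ C) (π : Measure Z)
    [IsFiniteMeasure π] : Integrable c π :=
  Integrable.of_bound hc.aestronglyMeasurable C (.of_forall hC)

lemma abs_integral_le_of_abs_le (hC : ∀ z, |c z| ≤ C) (π : Measure Z)
    [IsFiniteMeasure π] : |∫ z, c z ∂π| ≤ C * π.real Set.univ := by
  simpa using norm_integral_le_of_norm_le_const (μ := π) (f := c) (.of_forall hC)

lemma affinePart_midpoint (hc : Measurable c) (hC : ∀ z, |c z| ≤ C) (π π' : Measure Z)
    [IsFiniteMeasure π] [IsFiniteMeasure π'] :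
    2 * affinePart lam ε c (midpointMeasure π π')
      = affinePart lam ε c π + affinePart lam ε c π' := by
  have h1 : (midpointMeasure π π').real Set.univ
      = 2⁻¹ * (π.real Set.univ + π'.real Set.univ) := by
    rw [midpointMeasure, measureReal_nnreal_smul_apply, measureReal_add_apply]
    simp
  have h2 : ∫ z, c z ∂(midpointMeasure π π') = 2⁻¹ * (∫ z, c z ∂π + ∫ z, c z ∂π') := by
    rw [midpointMeasure, integral_smul_nnreal_measure,
      integral_add_measure (integrable_of_abs_le hc hC π) (integrable_of_abs_le hc hC π'),
      NNReal.smul_def, smul_eq_mul]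
    simp
  rw [affinePart, affinePart, affinePart, h1, h2]
  ring

lemma ac_of_convexPart (hε : 0 < ε) {π : Measure Z} (h : convexPart lam ε D π ≠ ∞) : π ≪ lam :=
  (klDiv_ne_top_iff.1 (klDiv_ne_top_of_convexPart hε h)).1

variable [IsFiniteMeasure lam]

/-- Separates a real-valued affine part from a `[0, ∞]`-valued convex part, so that infinite values
occur only in the latter. -/
lemma regObjective_eq (hε : 0 < ε) (π : Measure Z) [IsFiniteMeasure π] :
    regObjective lam ε c D π
      = (affinePart lam ε c π : EReal) + ((convexPart lam ε D π : ℝ≥0∞) : EReal) := by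
  rw [regObjective, entropy_eq_klDiv, affinePart, convexPart, EReal.coe_ennreal_add,
    EReal.coe_ennreal_mul, EReal.coe_ennreal_ofReal, max_eq_left hε.le,
    EReal.left_distrib_of_nonneg_of_ne_top (by exact_mod_cast hε.le) (EReal.coe_ne_top _),
    EReal.coe_add, EReal.coe_mul]
  simp only [add_assoc]

lemma regObjective_ne_top_iff (hε : 0 < ε) (π : Measure Z) [IsFiniteMeasure π] :
    regObjective lam ε c D π ≠ ⊤ ↔ convexPart lam ε D π ≠ ∞ := by
  rw [regObjective_eq hε, not_iff_not]
  constructor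
  · intro h
    by_contra h'
    rw [← EReal.coe_ennreal_toReal h', ← EReal.coe_add] at h
    exact EReal.coe_ne_top _ h
  · intro h
    rw [h, EReal.coe_ennreal_top, EReal.coe_add_top]

lemma regObjective_eq_coe (hε : 0 < ε) {π : Measure Z} [IsFiniteMeasure π]
    (h : convexPart lam ε D π ≠ ∞) :
    regObjective lam ε c D π = (realObjective lam ε c D π : EReal) := by
  rw [regObjective_eq hε, realObjective, ← EReal.coe_ennreal_toReal h, EReal.coe_add]

/-- The regularized objective is coercive in the mass. -/
lemma mass_le_realObjective (hε : 0 < ε) (hC : ∀ z, |c z| ≤ C) {π : Measure Z}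
    [IsFiniteMeasure π] (h : convexPart lam ε D π ≠ ∞) :
    π.real Set.univ ≤ realObjective lam ε c D π
      + ε * Real.exp ((C + 1) / ε) * lam.real Set.univ := by
  have hkl := klDiv_ne_top_of_convexPart hε h
  -- Slope (C + 1) / ε: after multiplication by ε it absorbs the worst cost -C per unit mass and
  -- leaves one full copy of the mass.
  have h1 := mul_measureReal_le_klDiv lam π hkl ((C + 1) / ε)
  have h2 := (abs_le.1 (abs_integral_le_of_abs_le hC π)).1
  have h3 : ε * (klDiv π lam).toReal ≤ (convexPart lam ε D π).toReal := by
    have := ENNReal.toReal_mono h (le_self_add : ENNReal.ofReal ε * klDiv π lam ≤ _)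
    rwa [ENNReal.toReal_mul, ENNReal.toReal_ofReal hε.le] at this
  have h4 := mul_le_mul_of_nonneg_left h1 hε.le
  have h5 : ε * ((C + 1) / ε * π.real Set.univ) = (C + 1) * π.real Set.univ := by field_simp
  have h6 : 0 ≤ ε * π.real Set.univ := by positivity
  rw [h5] at h4
  rw [realObjective, affinePart]
  nlinarith

lemma regObjective_ne_bot (hε : 0 < ε) (π : Measure Z) [IsFiniteMeasure π] :
    regObjective lam ε c D π ≠ ⊥ := by
  by_cases h : convexPart lam ε D π = ∞
  · rw [not_ne_iff.1 ((regObjective_ne_top_iff (c := c) hε π).not.2 (not_ne_iff.2 h))]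
    exact top_ne_bot
  · rw [regObjective_eq_coe hε h]
    exact EReal.coe_ne_bot _

/-- A lower bound of the regularized objective. -/
lemma coe_le_regObjective (hε : 0 < ε) (hC : ∀ z, |c z| ≤ C) (π : Measure Z) [IsFiniteMeasure π] :
    ((-(ε * Real.exp ((C + 1) / ε) * lam.real Set.univ) : ℝ) : EReal)
      ≤ regObjective lam ε c D π := by
  by_cases h : convexPart lam ε D π = ∞
  · rw [not_ne_iff.1 ((regObjective_ne_top_iff (c := c) hε π).not.2 (not_ne_iff.2 h))]
    exact le_top
  · rw [regObjective_eq_coe hε h, EReal.coe_le_coe_iff]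
    linarith [mass_le_realObjective (c := c) hε hC h, measureReal_nonneg (μ := π) (s := Set.univ)]

lemma convexPart_midpoint (hD : IsConvexLSC D) (π π' : Measure Z) [IsFiniteMeasure π]
    [IsFiniteMeasure π'] :
    2 * convexPart lam ε D (midpointMeasure π π') + ENNReal.ofReal ε * hellinger lam π π'
      ≤ convexPart lam ε D π + convexPart lam ε D π' := by
  have h1 := two_mul_klDiv_midpoint_add_hellinger_le lam π π'
  have h2 := hD.midpoint π π'
  calc _ = ENNReal.ofReal ε * (2 * klDiv (midpointMeasure π π') lam + hellinger lam π π')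
        + 2 * D (midpointMeasure π π') := by unfold convexPart; ring
    _ ≤ ENNReal.ofReal ε * (klDiv π lam + klDiv π' lam) + (D π + D π') := by gcongr
    _ = _ := by unfold convexPart; ring

/-- Two near-minimizers of the regularized objective are close in Hellinger distance. -/
lemma hellinger_le_of_near_min (hε : 0 < ε) (hc : Measurable c) (hC : ∀ z, |c z| ≤ C)
    (hD : IsConvexLSC D) {v η : ℝ}
    (hv : ∀ (π : Measure Z) [IsFiniteMeasure π], convexPart lam ε D π ≠ ∞ →
      v ≤ realObjective lam ε c D π)
    {π π' : Measure Z} [IsFiniteMeasure π] [IsFiniteMeasure π']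
    (h : convexPart lam ε D π ≠ ∞) (h' : convexPart lam ε D π' ≠ ∞)
    (hη : realObjective lam ε c D π ≤ v + η) (hη' : realObjective lam ε c D π' ≤ v + η) :
    hellinger lam π π' ≤ ENNReal.ofReal (2 * η / ε) := by
  have h1 := convexPart_midpoint (lam := lam) (ε := ε) hD π π'
  have hfin : convexPart lam ε D π + convexPart lam ε D π' ≠ ∞ := ENNReal.add_ne_top.2 ⟨h, h'⟩
  have hm : convexPart lam ε D (midpointMeasure π π') ≠ ∞ := by
    intro ht
    rw [ht] at h1
    exact hfin (top_le_iff.1 (le_trans (by simp [ENNReal.mul_top]) h1))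
  have hh : hellinger lam π π' ≠ ∞ := by
    intro ht
    rw [ht, ENNReal.mul_top (by simpa using hε)] at h1
    exact hfin (top_le_iff.1 (le_trans (by simp) h1))
  have h2 := ENNReal.toReal_mono hfin h1
  rw [ENNReal.toReal_add h h', ENNReal.toReal_add (ENNReal.mul_ne_top (by simp) hm)
    (ENNReal.mul_ne_top (by simp) hh), ENNReal.toReal_mul, ENNReal.toReal_mul,
    ENNReal.toReal_ofReal hε.le] at h2
  -- The midpoint also has value at least v, so 2v cancels and only 2η is left to bound ε times the
  -- Hellinger term.
  have h3 := hv _ hm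
  have h4 := affinePart_midpoint (lam := lam) (ε := ε) hc hC π π'
  rw [realObjective] at h3 hη hη'
  rw [← ENNReal.ofReal_toReal hh]
  refine ENNReal.ofReal_le_ofReal ?_
  rw [le_div_iff₀ hε]
  simp only [ENNReal.toReal_ofNat] at h2
  linarith

/-- Two near-minimizers of the regularized objective are close in total variation. -/
lemma exists_densityDist_le (hε : 0 < ε) (hc : Measurable c) (hC : ∀ z, |c z| ≤ C)
    (hD : IsConvexLSC D) {v : ℝ}
    (hv : ∀ (π : Measure Z) [IsFiniteMeasure π], convexPart lam ε D π ≠ ∞ →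
      v ≤ realObjective lam ε c D π) {τ : ℝ} (hτ : 0 < τ) :
    ∃ η > 0, ∀ (π π' : Measure Z) [IsFiniteMeasure π] [IsFiniteMeasure π'],
      convexPart lam ε D π ≠ ∞ → convexPart lam ε D π' ≠ ∞ →
      realObjective lam ε c D π ≤ v + η → realObjective lam ε c D π' ≤ v + η →
      densityDist lam π π' ≤ ENNReal.ofReal τ := by
  -- Mass bound for every plan whose value is at most v + 1.
  set M := |v| + 1 + ε * Real.exp ((C + 1) / ε) * lam.real Set.univ with hM
  have hMpos : 0 < M := by positivity
  have hδ : 0 < τ / (4 * M) := by positivity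
  -- With δ = τ / (4M) the mass term δ · 2M is τ / 2; with η ≤ δτε / 4 the Hellinger term δ⁻¹ · 2η /
  -- ε is at most τ / 2.
  refine ⟨min 1 (τ / (4 * M) * τ * ε / 4), by positivity, fun π π' _ _ h h' hη hη' => ?_⟩
  have h1 := hellinger_le_of_near_min hε hc hC hD hv h h' hη hη'
  have hmass : ∀ (ρ : Measure Z) [IsFiniteMeasure ρ], convexPart lam ε D ρ ≠ ∞ →
      realObjective lam ε c D ρ ≤ v + min 1 (τ / (4 * M) * τ * ε / 4) →
      ρ Set.univ ≤ ENNReal.ofReal M := by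
    intro ρ _ hρ hρη
    rw [← ofReal_measureReal]
    refine ENNReal.ofReal_le_ofReal ?_
    have := mass_le_realObjective (c := c) hε hC hρ
    have h3 : min 1 (τ / (4 * M) * τ * ε / 4) ≤ 1 := min_le_left _ _
    linarith [le_abs_self v]
  calc densityDist lam π π' ≤ _ := densityDist_le lam π π' hδ
    _ ≤ ENNReal.ofReal (τ / (4 * M))⁻¹ * ENNReal.ofReal (τ / (4 * M) * τ / 2)
        + ENNReal.ofReal (τ / (4 * M)) * (ENNReal.ofReal M + ENNReal.ofReal M) := by
        gcongr
        · refine h1.trans (ENNReal.ofReal_le_ofReal ?_)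
          rw [div_le_iff₀ hε]
          linarith [min_le_right 1 (τ / (4 * M) * τ * ε / 4)]
        · exact hmass π h hη
        · exact hmass π' h' hη'
    _ = ENNReal.ofReal τ := by
        rw [← ENNReal.ofReal_add hMpos.le hMpos.le, ← ENNReal.ofReal_mul (by positivity),
          ← ENNReal.ofReal_mul (by positivity), ← ENNReal.ofReal_add (by positivity)
          (by positivity)]
        congr 1
        field_simp
        ring

/-- A sequence that is Cauchy for `densityDist` has a subsequence that converges at a summable
rate. -/
lemma exists_summablyClose_subseq (πn : ℕ → Measure Z) [∀ n, IsFiniteMeasure (πn n)]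
    (hac : ∀ n, πn n ≪ lam)
    (hcau : ∀ τ : ℝ, 0 < τ → ∃ n₀, ∀ m ≥ n₀, ∀ n ≥ n₀,
      densityDist lam (πn m) (πn n) ≤ ENNReal.ofReal τ) :
    ∃ (π : Measure Z) (s : ℕ → ℕ), IsFiniteMeasure π ∧ π ≪ lam ∧ (∀ k, k ≤ s k) ∧
      SummablyClose (fun k => πn (s k)) π := by
  have hint : ∀ n, Integrable (fun z => ((πn n).rnDeriv lam z).toReal) lam :=
    fun n => Measure.integrable_toReal_rnDeriv
  set u : ℕ → Lp ℝ 1 lam := fun n => (hint n).toL1 _ with hu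
  have hdist : ∀ m n, edist (u m) (u n) = densityDist lam (πn m) (πn n) := by
    intro m n
    rw [hu, Integrable.edist_toL1_toL1]
    simp only [densityDist, edist_dist, Real.dist_eq]
  have hc : CauchySeq u := by
    rw [Metric.cauchySeq_iff]
    intro τ hτ
    obtain ⟨n₀, hn₀⟩ := hcau (τ / 2) (by positivity)
    refine ⟨n₀, fun m hm n hn => ?_⟩
    have := hn₀ m hm n hn
    rw [← hdist, edist_dist, ENNReal.ofReal_le_ofReal_iff (by positivity)] at this
    linarith
  obtain ⟨w, hw⟩ := cauchySeq_tendsto_of_complete hc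
  have hwm : Measurable w := (Lp.stronglyMeasurable w).measurable
  have hwi : Integrable w lam := L1.integrable_coeFn w
  -- Geometric closeness to the L¹ limit makes the total variation errors summable.
  have hs : ∀ k : ℕ, ∃ n, k ≤ n ∧ edist (u n) w ≤ (2⁻¹ : ℝ≥0∞) ^ k := by
    intro k
    have h1 := (EMetric.tendsto_atTop.1 hw) ((2⁻¹ : ℝ≥0∞) ^ k)
      (ENNReal.pow_pos (by simp) k)
    obtain ⟨n₀, hn₀⟩ := h1
    exact ⟨max k n₀, le_max_left _ _, (hn₀ _ (le_max_right _ _)).le⟩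
  choose s hsk hs using hs
  have hfin : IsFiniteMeasure (lam.withDensity fun z => ENNReal.ofReal (w z)) :=
    isFiniteMeasure_withDensity_ofReal hwi.2
  set π := lam.withDensity fun z => ENNReal.ofReal (w z) with hπ
  have hπac : π ≪ lam := withDensity_absolutelyContinuous _ _
  -- The representative `w` may be negative on a null set; passing to its positive part does not
  -- increase the distance to a nonnegative density.
  have hd : ∀ n, densityDist lam (πn n) π ≤ edist (u n) w := by
    intro n
    have h1 : edist (u n) w = ∫⁻ z, edist (((πn n).rnDeriv lam z).toReal) (w z) ∂lam := by
      nth_rewrite 1 [← Integrable.toL1_coeFn w hwi]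
      rw [hu, Integrable.edist_toL1_toL1]
    rw [h1, densityDist]
    refine lintegral_mono_ae ?_
    filter_upwards [Measure.rnDeriv_withDensity lam hwm.ennreal_ofReal] with z hz
    rw [hz, edist_dist, Real.dist_eq]
    refine ENNReal.ofReal_le_ofReal ?_
    rw [ENNReal.toReal_ofReal']
    have h0 : 0 ≤ ((πn n).rnDeriv lam z).toReal := ENNReal.toReal_nonneg
    rcases le_total (w z) 0 with hz | hz
    · rw [max_eq_right hz, sub_zero, abs_of_nonneg h0, abs_of_nonneg (by linarith)]
      linarith
    · rw [max_eq_left hz]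
  refine ⟨π, s, hfin, hπac, hsk, fun k => lam.withDensity fun z =>
      ENNReal.ofReal |((πn (s k)).rnDeriv lam z).toReal - (π.rnDeriv lam z).toReal|, ?_,
      fun k => ⟨le_add_withDensity_abs_sub π (hac _), ?_⟩⟩
  · refine ne_top_of_le_ne_top (b := ∑' k, (2⁻¹ : ℝ≥0∞) ^ k) ?_ (ENNReal.tsum_le_tsum fun k => ?_)
    · rw [ENNReal.tsum_geometric]
      simp
    · rw [withDensity_apply _ MeasurableSet.univ, setLIntegral_univ]
      exact (hd _).trans (hs k)
  · simp only [abs_sub_comm _ (π.rnDeriv lam _).toReal]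
    exact le_add_withDensity_abs_sub _ hπac

lemma SummablyClose.tendsto_measureReal {πn : ℕ → Measure Z} {π : Measure Z}
    [∀ n, IsFiniteMeasure (πn n)] [IsFiniteMeasure π] (h : SummablyClose πn π) :
    Tendsto (fun n => (πn n).real Set.univ) atTop (𝓝 (π.real Set.univ)) := by
  obtain ⟨σ, hσ, hle⟩ := h
  exact (ENNReal.tendsto_toReal (measure_ne_top _ _)).comp (tendsto_of_le_add
    (measure_ne_top _ _) (ENNReal.tendsto_atTop_zero_of_tsum_ne_top hσ)
    (fun n => (hle n).1 _) (fun n => (hle n).2 _))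

lemma SummablyClose.tendsto_integral (hc : Measurable c) (hC : ∀ z, |c z| ≤ C)
    {πn : ℕ → Measure Z} {π : Measure Z} [∀ n, IsFiniteMeasure (πn n)] [IsFiniteMeasure π]
    (h : SummablyClose πn π) :
    Tendsto (fun n => ∫ z, c z ∂(πn n)) atTop (𝓝 (∫ z, c z ∂π)) := by
  have hmass := h.tendsto_measureReal
  obtain ⟨σ, hσ, hle⟩ := h
  have hfin : ∀ n, IsFiniteMeasure (σ n) := fun n =>
    ⟨(ENNReal.ne_top_of_tsum_ne_top hσ n).lt_top⟩
  have hσ0 : Tendsto (fun n => (σ n).real Set.univ) atTop (𝓝 0) := by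
    simpa [Function.comp_def, Measure.real] using (ENNReal.tendsto_toReal ENNReal.zero_ne_top).comp
      (ENNReal.tendsto_atTop_zero_of_tsum_ne_top hσ)
  -- Shifting the cost by C makes it nonnegative, hence its integral monotone in the measure;
  -- convergence of the masses removes the shift.
  have hpos : ∀ z, 0 ≤ c z + C := fun z => by linarith [(abs_le.1 (hC z)).1]
  have hint : ∀ (ρ : Measure Z) [IsFiniteMeasure ρ], Integrable (fun z => c z + C) ρ :=
    fun ρ _ => (integrable_of_abs_le hc hC ρ).add (integrable_const C)
  have key : ∀ (a b r : Measure Z) [IsFiniteMeasure a] [IsFiniteMeasure b] [IsFiniteMeasure r],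
      a ≤ b + r → ∫ z, (c z + C) ∂a ≤ ∫ z, (c z + C) ∂b + 2 * C * r.real Set.univ := by
    intro a b r _ _ _ hab
    calc ∫ z, (c z + C) ∂a ≤ ∫ z, (c z + C) ∂(b + r) :=
          integral_mono_measure hab (.of_forall hpos) (hint _)
      _ = ∫ z, (c z + C) ∂b + ∫ z, (c z + C) ∂r := integral_add_measure (hint _) (hint _)
      _ ≤ ∫ z, (c z + C) ∂b + ∫ _, 2 * C ∂r := by
          gcongr
          · exact hint r
          · exact integrable_const _
          · intro z
            simp only
            linarith [(abs_le.1 (hC z)).2]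
      _ = _ := by simp [mul_comm]
  have h1 : Tendsto (fun n => ∫ z, (c z + C) ∂(πn n)) atTop (𝓝 (∫ z, (c z + C) ∂π)) := by
    refine tendsto_of_tendsto_of_tendsto_of_le_of_le
      (g := fun n => ∫ z, (c z + C) ∂π - 2 * C * (σ n).real Set.univ)
      (h := fun n => ∫ z, (c z + C) ∂π + 2 * C * (σ n).real Set.univ) ?_ ?_ ?_ ?_
    · simpa using tendsto_const_nhds.sub (hσ0.const_mul (2 * C))
    · simpa using tendsto_const_nhds.add (hσ0.const_mul (2 * C))
    · intro n
      simp only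
      linarith [key _ _ _ (hle n).2]
    · intro n
      exact key _ _ _ (hle n).1
  have h2 := h1.sub (hmass.mul_const C)
  have e : ∀ (ρ : Measure Z) [IsFiniteMeasure ρ],
      ∫ z, (c z + C) ∂ρ - ρ.real Set.univ * C = ∫ z, c z ∂ρ := by
    intro ρ _
    rw [integral_add (integrable_of_abs_le hc hC ρ) (integrable_const C)]
    simp
  simpa only [e] using h2

/-- The regularized objective has a minimizer, to which all near-minimizers are close in total
variation. -/
theorem exists_minimizer (hε : 0 < ε) (hc : Measurable c) (hC : ∀ z, |c z| ≤ C)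
    (hD : IsConvexLSC D)
    (hfin : ∃ π : Measure Z, IsFiniteMeasure π ∧ regObjective lam ε c D π ≠ ⊤) :
    ∃ πhat : Measure Z, IsFiniteMeasure πhat ∧ regObjective lam ε c D πhat ≠ ⊤ ∧
      (∀ (π : Measure Z) [IsFiniteMeasure π],
        regObjective lam ε c D πhat ≤ regObjective lam ε c D π) ∧
      ∀ τ : ℝ, 0 < τ → ∃ η : ℝ, 0 < η ∧ ∀ (π : Measure Z) [IsFiniteMeasure π],
        regObjective lam ε c D π ≤ regObjective lam ε c D πhat + (η : EReal) →
        ∀ A : Set Z, |π.real A - πhat.real A| ≤ τ := by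
  set S : Set ℝ := {r | ∃ π : Measure Z, IsFiniteMeasure π ∧ convexPart lam ε D π ≠ ∞ ∧
    r = realObjective lam ε c D π} with hS
  have hne : S.Nonempty := by
    obtain ⟨π, hπ, h⟩ := hfin
    exact ⟨_, π, hπ, (regObjective_ne_top_iff hε π).1 h, rfl⟩
  have hbdd : BddBelow S := by
    refine ⟨-(ε * Real.exp ((C + 1) / ε) * lam.real Set.univ), ?_⟩
    rintro r ⟨π, hπ, h, rfl⟩
    linarith [mass_le_realObjective (c := c) hε hC h, measureReal_nonneg (μ := π) (s := Set.univ)]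
  set v := sInf S
  have hv : ∀ (π : Measure Z) [IsFiniteMeasure π], convexPart lam ε D π ≠ ∞ →
      v ≤ realObjective lam ε c D π := fun π hπ h => csInf_le hbdd ⟨π, hπ, h, rfl⟩
  have hseq : ∀ n : ℕ, ∃ π : Measure Z, IsFiniteMeasure π ∧ convexPart lam ε D π ≠ ∞ ∧
      realObjective lam ε c D π ≤ v + 1 / ((n : ℝ) + 1) := by
    intro n
    obtain ⟨r, ⟨π, hπ, h, rfl⟩, hr⟩ := exists_lt_of_csInf_lt hne
      (lt_add_of_pos_right v (Nat.one_div_pos_of_nat (n := n)))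
    exact ⟨π, hπ, h, hr.le⟩
  choose πn hπn hfn hvn using hseq
  obtain ⟨π, s, hπ, hac, hs, hcl⟩ := exists_summablyClose_subseq (lam := lam) πn
    (fun n => ac_of_convexPart hε (hfn n)) (by
      intro τ hτ
      obtain ⟨η, hη, h⟩ := exists_densityDist_le hε hc hC hD hv hτ
      obtain ⟨n₀, hn₀⟩ := exists_nat_one_div_lt hη
      have hle : ∀ m ≥ n₀, 1 / ((m : ℝ) + 1) ≤ η := fun m hm =>
        (Nat.one_div_le_one_div hm).trans hn₀.le
      exact ⟨n₀, fun m hm n hn => h _ _ (hfn m) (hfn n)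
        ((hvn m).trans (by linarith [hle m hm])) ((hvn n).trans (by linarith [hle n hn]))⟩)
  -- The affine part is continuous along the subsequence, so the upper bound on the convex part
  -- passes to the limit.
  have hlim : Tendsto (fun k : ℕ => ENNReal.ofReal
      (v + 1 / ((k : ℝ) + 1) - affinePart lam ε c (πn (s k)))) atTop
      (𝓝 (ENNReal.ofReal (v - affinePart lam ε c π))) := by
    refine ENNReal.tendsto_ofReal ?_
    have h1 : Tendsto (fun k : ℕ => v + 1 / ((k : ℝ) + 1)) atTop (𝓝 v) := by
      simpa using tendsto_const_nhds.add (tendsto_one_div_add_atTop_nhds_zero_nat (𝕜 := ℝ))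
    exact h1.sub ((hcl.tendsto_integral hc hC).add
      ((hcl.tendsto_measureReal.sub_const _).const_mul ε))
  have hconv : ∀ k, convexPart lam ε D (πn (s k))
      ≤ ENNReal.ofReal (v + 1 / ((k : ℝ) + 1) - affinePart lam ε c (πn (s k))) := by
    intro k
    rw [← ENNReal.ofReal_toReal (hfn (s k))]
    refine ENNReal.ofReal_le_ofReal ?_
    have h1 := hvn (s k)
    rw [realObjective] at h1
    have h2 : 1 / ((s k : ℝ) + 1) ≤ 1 / ((k : ℝ) + 1) := Nat.one_div_le_one_div (hs k)
    linarith
  have hG : convexPart lam ε D π ≤ ENNReal.ofReal (v - affinePart lam ε c π) := by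
    calc convexPart lam ε D π
        ≤ liminf (fun k => ENNReal.ofReal ε * klDiv (πn (s k)) lam) atTop
          + liminf (fun k => D (πn (s k))) atTop := by
          refine add_le_add ?_ (hD.lsc _ _ hcl)
          rw [ENNReal.liminf_const_mul_of_ne_top ENNReal.ofReal_ne_top]
          gcongr
          exact hcl.klDiv_le_liminf hac
      _ ≤ liminf (fun k => convexPart lam ε D (πn (s k))) atTop := ennreal_le_liminf_add _ _
      _ ≤ _ := (liminf_le_liminf (.of_forall hconv)).trans hlim.liminf_eq.le
  have hGfin : convexPart lam ε D π ≠ ∞ := ne_top_of_le_ne_top ENNReal.ofReal_ne_top hG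
  -- `ENNReal.ofReal` truncates at 0; nonnegativity is needed to read `hG` as a real inequality.
  have hpos : 0 ≤ v - affinePart lam ε c π := by
    have h1 : Tendsto (fun k : ℕ => v + 1 / ((k : ℝ) + 1) - affinePart lam ε c (πn (s k))) atTop
        (𝓝 (v - affinePart lam ε c π)) := by
      have h1 : Tendsto (fun k : ℕ => v + 1 / ((k : ℝ) + 1)) atTop (𝓝 v) := by
        simpa using tendsto_const_nhds.add (tendsto_one_div_add_atTop_nhds_zero_nat (𝕜 := ℝ))
      exact h1.sub ((hcl.tendsto_integral hc hC).add
        ((hcl.tendsto_measureReal.sub_const _).const_mul ε))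
    refine ge_of_tendsto' h1 fun k => ?_
    have h1 := hvn (s k)
    rw [realObjective] at h1
    have h2 : 1 / ((s k : ℝ) + 1) ≤ 1 / ((k : ℝ) + 1) := Nat.one_div_le_one_div (hs k)
    linarith [ENNReal.toReal_nonneg (a := convexPart lam ε D (πn (s k)))]
  have hval : realObjective lam ε c D π = v := by
    refine le_antisymm ?_ (hv π hGfin)
    have := ENNReal.toReal_mono ENNReal.ofReal_ne_top hG
    rw [ENNReal.toReal_ofReal hpos] at this
    rw [realObjective]
    linarith
  refine ⟨π, hπ, (regObjective_ne_top_iff hε π).2 hGfin, fun ρ _ => ?_, fun τ hτ => ?_⟩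
  · by_cases h : convexPart lam ε D ρ = ∞
    · rw [not_ne_iff.1 ((regObjective_ne_top_iff (c := c) hε ρ).not.2 (not_ne_iff.2 h))]
      exact le_top
    · rw [regObjective_eq_coe hε h, regObjective_eq_coe hε hGfin, hval]
      exact_mod_cast hv ρ h
  · obtain ⟨η, hη, h⟩ := exists_densityDist_le hε hc hC hD hv hτ
    refine ⟨η, hη, fun ρ _ hρ A => ?_⟩
    rw [regObjective_eq_coe hε hGfin, hval, ← EReal.coe_add] at hρ
    have hρfin := (regObjective_ne_top_iff hε ρ).1 (ne_top_of_le_ne_top (EReal.coe_ne_top _) hρ)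
    rw [regObjective_eq_coe hε hρfin, EReal.coe_le_coe_iff] at hρ
    exact abs_measureReal_sub_le_of_densityDist_le (ac_of_convexPart hε hρfin) hac hτ.le
      (h ρ π hρfin hGfin hρ (by linarith)) A

end DirectMethod

/-! ### Entropy under projections, and Gibbs' inequality. -/

section Marginals

variable {Z W : Type*} [MeasurableSpace Z] [MeasurableSpace W]

lemma entropy_zero_ne_top (lam : Measure Z) : entropy lam 0 ≠ ⊤ :=
  entropy_ne_top_iff.2 ⟨Measure.AbsolutelyContinuous.zero _, integrable_zero_measure⟩

/-- Finiteness of the entropy is inherited by image measures. -/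
lemma entropy_map_ne_top {lam π : Measure Z} {lamW : Measure W} [IsFiniteMeasure lam]
    [IsFiniteMeasure π] [IsFiniteMeasure lamW] {p : Z → W} (hp : Measurable p) {C : ℝ≥0∞}
    (hC : C ≠ ∞) (hlam : lam.map p = C • lamW) (h : entropy lam π ≠ ⊤) :
    entropy lamW (π.map p) ≠ ⊤ := by
  obtain ⟨hac, hint⟩ := entropy_ne_top_iff.1 h
  by_cases hC0 : C = 0
  · rw [hC0, zero_smul, Measure.map_eq_zero_iff hp.aemeasurable] at hlam
    rw [hlam, Measure.absolutelyContinuous_zero_iff] at hac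
    rw [hac, Measure.map_zero]
    exact entropy_zero_ne_top _
  have hac' : π.map p ≪ C • lamW := hlam ▸ hac.map hp
  have hacW : π.map p ≪ lamW := hac'.trans (Measure.smul_absolutelyContinuous)
  refine entropy_ne_top_iff.2 ⟨hacW, ?_⟩
  have h1 := integrable_llr_map hac hp hint
  rw [hlam, integrable_congr (llr_smul_right hacW C hC0 hC)] at h1
  exact (h1.add (integrable_const (Real.log C.toReal))).congr (.of_forall fun _ => by simp)

/-- Gibbs' inequality for a reference density `q` of the same total mass. -/
lemma integral_log_le_integral_llr {lam π : Measure Z} [IsFiniteMeasure lam] [IsFiniteMeasure π]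
    {q : Z → ℝ≥0∞} (hq : Measurable q) (hac : π ≪ lam) (hint : Integrable (llr π lam) π)
    (hmass : lam.withDensity q Set.univ = π Set.univ) (hpos : ∀ᵐ z ∂π, q z ≠ 0)
    (hlog : Integrable (fun z => Real.log (q z).toReal) π) :
    ∫ z, Real.log (q z).toReal ∂π ≤ ∫ z, llr π lam z ∂π := by
  have hfin : IsFiniteMeasure (lam.withDensity q) := ⟨hmass ▸ measure_lt_top π _⟩
  have hqt : ∀ᵐ z ∂lam, q z < ∞ := by
    refine ae_lt_top hq ?_
    rw [← setLIntegral_univ, ← withDensity_apply _ MeasurableSet.univ, hmass]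
    exact measure_ne_top _ _
  have hac' : π ≪ lam.withDensity q := by
    refine Measure.AbsolutelyContinuous.mk fun A hA h0 => ?_
    rw [withDensity_apply_eq_zero hq] at h0
    have h1 : π ({z | q z ≠ 0} ∩ A) = 0 := hac h0
    have h2 : π {z | q z ≠ 0}ᶜ = 0 := mem_ae_iff.1 hpos
    refine measure_mono_null (fun z hz => ?_) (measure_union_null h1 h2)
    by_cases h : q z = 0
    · right; simpa using h
    · left; exact ⟨h, hz⟩
  -- Chain rule: dπ/dlam = (dπ/d(q lam)) · q, valid π-a.e.
  have hll : llr π (lam.withDensity q) =ᵐ[π] fun z => llr π lam z - Real.log (q z).toReal := by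
    filter_upwards [hac.ae_le (Measure.rnDeriv_mul_rnDeriv (κ := lam) hac'),
      hac.ae_le (Measure.rnDeriv_withDensity lam hq), hpos, hac.ae_le hqt,
      Measure.rnDeriv_pos hac, hac.ae_le (Measure.rnDeriv_lt_top π lam)] with z h1 h2 h3 h4 h5 h6
    rw [Pi.mul_apply, h2] at h1
    have h7 : (π.rnDeriv (lam.withDensity q) z).toReal ≠ 0 := by
      intro h0
      have := congrArg ENNReal.toReal h1
      rw [ENNReal.toReal_mul, h0, zero_mul] at this
      exact (ENNReal.toReal_pos h5.ne' h6.ne).ne this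
    have h8 : (q z).toReal ≠ 0 := (ENNReal.toReal_pos h3 h4.ne).ne'
    simp only [llr]
    rw [← h1, ENNReal.toReal_mul, Real.log_mul h7 h8]
    ring
  have hint' : Integrable (llr π (lam.withDensity q)) π :=
    (integrable_congr hll).2 (hint.sub hlog)
  -- Nonnegativity of the divergence of π from q lam; the mass terms cancel by `hmass`.
  have h := integral_llr_add_sub_measure_univ_nonneg hac' hint'
  rw [integral_congr_ae hll, integral_sub hint hlog, Measure.real, Measure.real, hmass] at h
  linarith

lemma lintegral_pi_prod {n : ℕ} {X : Fin n → Type*} [∀ i, MeasurableSpace (X i)]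
    (lam : ∀ i, Measure (X i)) [∀ i, SigmaFinite (lam i)] {f : ∀ i, X i → ℝ≥0∞}
    (hf : ∀ i, Measurable (f i)) :
    ∫⁻ x, ∏ i, f i (x i) ∂(Measure.pi lam) = ∏ i, ∫⁻ x, f i x ∂(lam i) := by
  induction n with
  | zero => simp
  | succ n ih =>
    have hm : Measurable fun x : ∀ i : Fin n, X i.succ => ∏ i, f i.succ (x i) :=
      Finset.measurable_prod _ fun (i : Fin n) _ => (hf i.succ).comp (measurable_pi_apply i)
    have key : ∫⁻ x : X 0 × (∀ i : Fin n, X i.succ), f 0 x.1 * ∏ i, f i.succ (x.2 i)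
        ∂((lam 0).prod (Measure.pi fun i : Fin n => lam i.succ))
        = ∏ i, ∫⁻ x, f i x ∂(lam i) := by
      rw [Fin.prod_univ_succ, ← ih (fun i : Fin n => lam i.succ) fun i : Fin n => hf i.succ]
      exact lintegral_prod_mul (hf 0).aemeasurable hm.aemeasurable
    have h := ((measurePreserving_piFinSuccAbove lam 0).symm).lintegral_comp_emb
      (MeasurableEquiv.measurableEmbedding _) (fun x => ∏ i, f i (x i))
    refine h.symm.trans (Eq.trans (lintegral_congr fun x => ?_) key)
    rw [Fin.prod_univ_succ]
    rfl

end Marginals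

/-! ### Gluing pair plans along a common marginal. -/

section Glue

variable {N : ℕ} {X : Fin N → Type*} {Y : Type*} [∀ i, MeasurableSpace (X i)] [MeasurableSpace Y]

/-- The projection of the multi-marginal space to the factors `X i` and `Y`. -/
def pairProj (X : Fin N → Type*) (Y : Type*) (i : Fin N) (z : (∀ i, X i) × Y) : X i × Y :=
  (z.1 i, z.2)

lemma measurable_pairProj (i : Fin N) : Measurable (pairProj X Y i) := by
  unfold pairProj; fun_prop

/-- The density of the plan that glues bimarginal plans with densities `f i` along their common
marginal on `Y` with density `g`. -/
noncomputable def glueDensity (f : ∀ i, X i × Y → ℝ≥0∞) (g : Y → ℝ≥0∞) (z : (∀ i, X i) × Y) :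
    ℝ≥0∞ :=
  (∏ i, f i (pairProj X Y i z)) * (g z.2)⁻¹ ^ (N - 1)

lemma map_pairProj_snd (ρ : Measure ((∀ i, X i) × Y)) (i : Fin N) :
    (ρ.map (pairProj X Y i)).map Prod.snd = ρ.map Prod.snd := by
  rw [Measure.map_map measurable_snd (measurable_pairProj i)]
  rfl

lemma map_pairProj_fst (ρ : Measure ((∀ i, X i) × Y)) (i : Fin N) :
    (ρ.map (pairProj X Y i)).map Prod.fst = ρ.map (fun z => z.1 i) := by
  rw [Measure.map_map measurable_fst (measurable_pairProj i)]
  rfl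

/-- Each summand factors through one projection, so it integrates against the corresponding
marginal; finite entropies allow splitting the integral. -/
lemma integrable_sum_llr (lam : ∀ i, Measure (X i)) (lamY : Measure Y)
    {π : ∀ i, Measure (X i × Y)} {ξ : Measure Y} {ρ : Measure ((∀ i, X i) × Y)}
    (hρ : ∀ i, ρ.map (pairProj X Y i) = π i) (hρY : ρ.map Prod.snd = ξ)
    (hE : ∀ i, entropy ((lam i).prod lamY) (π i) ≠ ⊤) (hEY : entropy lamY ξ ≠ ⊤) :
    Integrable (fun z => ∑ i, llr (π i) ((lam i).prod lamY) (pairProj X Y i z)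
          - ((N : ℝ) - 1) * llr ξ lamY z.2) ρ ∧
    ∫ z, (∑ i, llr (π i) ((lam i).prod lamY) (pairProj X Y i z)
          - ((N : ℝ) - 1) * llr ξ lamY z.2) ∂ρ
      = ∑ i, ∫ w, llr (π i) ((lam i).prod lamY) w ∂(π i) - ((N : ℝ) - 1) * ∫ y, llr ξ lamY y ∂ξ := by
  have h1 : ∀ i, Integrable (fun z => llr (π i) ((lam i).prod lamY) (pairProj X Y i z)) ρ := by
    intro i
    have := (entropy_ne_top_iff.1 (hE i)).2
    rw [← hρ i] at this
    rw [← hρ i]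
    exact this.comp_measurable (measurable_pairProj i)
  have h2 : Integrable (fun z => llr ξ lamY z.2) ρ := by
    have := (entropy_ne_top_iff.1 hEY).2
    rw [← hρY] at this
    rw [← hρY]
    exact this.comp_measurable measurable_snd
  have h3 := integrable_finsetSum Finset.univ fun i _ => h1 i
  refine ⟨h3.sub (h2.const_mul _), ?_⟩
  rw [integral_sub h3 (h2.const_mul _), integral_finsetSum _ fun i _ => h1 i,
    integral_const_mul]
  congr 1
  · refine Finset.sum_congr rfl fun i _ => ?_
    conv_rhs => rw [← hρ i]
    rw [integral_map (measurable_pairProj i).aemeasurable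
      (measurable_llr _ _).aestronglyMeasurable, hρ i]
  · congr 1
    conv_rhs => rw [← hρY]
    rw [integral_map measurable_snd.aemeasurable (measurable_llr _ _).aestronglyMeasurable, hρY]

variable {f : ∀ i, X i × Y → ℝ≥0∞} {g : Y → ℝ≥0∞}

lemma measurable_glueDensity (hf : ∀ i, Measurable (f i)) (hg : Measurable g) :
    Measurable (glueDensity f g) :=
  (Finset.measurable_prod _ fun i _ => (hf i).comp (measurable_pairProj i)).mul
    ((hg.comp measurable_snd).inv.pow_const _)

variable (lam : ∀ i, Measure (X i)) [∀ i, IsFiniteMeasure (lam i)] (lamY : Measure Y)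
  [IsFiniteMeasure lamY]

/-- Over a fixed y the integral factorizes, and the N - 1 factors other than i each integrate to g
y, cancelling the inverse power. -/
lemma lintegral_mul_glueDensity_fiber (hf : ∀ i, Measurable (f i)) (i : Fin N) {y : Y}
    (hy : g y < ∞) (hfg : ∀ i, ∫⁻ x, f i (x, y) ∂(lam i) = g y) {Φ : X i × Y → ℝ≥0∞}
    (hΦ : Measurable Φ) (hΦ1 : ∀ w, Φ w ≤ 1) :
    ∫⁻ x, Φ (pairProj X Y i (x, y)) * glueDensity f g (x, y) ∂(Measure.pi lam)
      = ∫⁻ x, Φ (x, y) * f i (x, y) ∂(lam i) := by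
  set G : ∀ j, X j → ℝ≥0∞ := Function.update (fun _ _ => 1) i fun x => Φ (x, y) with hG
  have hGm : ∀ j, Measurable (G j) := by
    intro j
    by_cases h : j = i
    · subst h
      rw [hG, Function.update_self]
      fun_prop
    · rw [hG, Function.update_of_ne h]
      exact measurable_const
  have hfm : ∀ j, Measurable fun x => f j (x, y) := fun j => (hf j).comp (by fun_prop)
  have h1 : ∀ x : ∀ j, X j, Φ (pairProj X Y i (x, y)) * glueDensity f g (x, y)
      = (∏ j, G j (x j) * f j (x j, y)) * (g y)⁻¹ ^ (N - 1) := by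
    intro x
    rw [Finset.prod_mul_distrib, Finset.prod_eq_single i, hG, Function.update_self, glueDensity]
    · simp only [pairProj, mul_assoc]
    · intro j _ hj
      rw [hG, Function.update_of_ne hj]
    · simp
  simp_rw [h1]
  rw [lintegral_mul_const, lintegral_pi_prod lam (f := fun j x => G j x * f j (x, y)) fun j => (hGm j).mul (hfm j),
    ← Finset.mul_prod_erase Finset.univ _ (Finset.mem_univ i)]
  swap
  · exact Finset.measurable_prod _ fun j _ =>
      ((hGm j).mul (hfm j)).comp (measurable_pi_apply j)
  have h2 : ∏ j ∈ Finset.univ.erase i, ∫⁻ x, G j x * f j (x, y) ∂(lam j) = g y ^ (N - 1) := by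
    rw [Finset.prod_congr rfl (g := fun _ => g y), Finset.prod_const,
      Finset.card_erase_of_mem (Finset.mem_univ i), Finset.card_univ, Fintype.card_fin]
    intro j hj
    rw [hG, Function.update_of_ne (Finset.ne_of_mem_erase hj), ← hfg j]
    simp
  rw [h2, hG, Function.update_self, mul_assoc, ← mul_pow]
  -- Here (g y)⁻¹ = ∞, but `f i` has zero integral on the fibre, and Φ ≤ 1 makes both sides vanish.
  by_cases h0 : g y = 0
  · have h3 : ∫⁻ x, Φ (x, y) * f i (x, y) ∂(lam i) = 0 := by
      refine le_antisymm ?_ zero_le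
      rw [← h0, ← hfg i]
      exact lintegral_mono fun x => mul_le_of_le_one_left' (hΦ1 _)
    rw [h3, zero_mul]
  · rw [ENNReal.mul_inv_cancel h0 hy.ne, one_pow, mul_one]

/-- The glued density has the given bimarginal densities. -/
lemma map_withDensity_glueDensity (hf : ∀ i, Measurable (f i)) (hg : Measurable g)
    (hfg : ∀ᵐ y ∂lamY, g y < ∞ ∧ ∀ i, ∫⁻ x, f i (x, y) ∂(lam i) = g y) (i : Fin N) :
    (((Measure.pi lam).prod lamY).withDensity (glueDensity f g)).map (pairProj X Y i)
      = ((lam i).prod lamY).withDensity (f i) := by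
  have hq := measurable_glueDensity hf hg
  ext A hA
  have hΦ : Measurable (A.indicator (1 : X i × Y → ℝ≥0∞)) := measurable_one.indicator hA
  have hp := measurable_pairProj (X := X) (Y := Y) i
  rw [Measure.map_apply hp hA, withDensity_apply _ (hp hA), withDensity_apply _ hA,
    ← lintegral_indicator hA, ← lintegral_indicator (hp hA)]
  have e1 : ∀ z, (pairProj X Y i ⁻¹' A).indicator (glueDensity f g) z
      = A.indicator 1 (pairProj X Y i z) * glueDensity f g z := by
    intro z
    by_cases h : pairProj X Y i z ∈ A <;> simp [Set.indicator, h]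
  have e2 : ∀ w, A.indicator (f i) w = A.indicator 1 w * f i w := by
    intro w
    by_cases h : w ∈ A <;> simp [Set.indicator, h]
  simp_rw [e1, e2]
  rw [lintegral_prod_symm' (fun z => A.indicator 1 (pairProj X Y i z) * glueDensity f g z)
    ((hΦ.comp hp).mul hq), lintegral_prod_symm' (fun w => A.indicator 1 w * f i w) (hΦ.mul (hf i))]
  refine lintegral_congr_ae ?_
  filter_upwards [hfg] with y hy
  exact lintegral_mul_glueDensity_fiber lam hf i hy.1 hy.2 hΦ
    (Set.indicator_le_self' (by simp))

/-- By Tonelli the fibre integrals form a density of the marginal; densities are a.e. unique. -/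
lemma ae_lintegral_rnDeriv_eq {A : Type*} [MeasurableSpace A] (lamA : Measure A)
    [IsFiniteMeasure lamA] {π : Measure (A × Y)} {ξ : Measure Y}
    [IsFiniteMeasure π] [IsFiniteMeasure ξ] (hac : π ≪ lamA.prod lamY)
    (hξ : π.map Prod.snd = ξ) :
    ∀ᵐ y ∂lamY, ∫⁻ x, π.rnDeriv (lamA.prod lamY) (x, y) ∂lamA = ξ.rnDeriv lamY y := by
  set f := π.rnDeriv (lamA.prod lamY)
  have hf : Measurable f := Measure.measurable_rnDeriv _ _
  have hm : Measurable fun y => ∫⁻ x, f (x, y) ∂lamA := hf.lintegral_prod_left'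
  have h : ξ = lamY.withDensity fun y => ∫⁻ x, f (x, y) ∂lamA := by
    rw [← hξ]
    ext B hB
    rw [Measure.map_apply measurable_snd hB, withDensity_apply _ hB,
      ← Measure.withDensity_rnDeriv_eq π _ hac, withDensity_apply _ (measurable_snd hB),
      ← Set.univ_prod, ← Measure.prod_restrict, lintegral_prod_symm' _ hf, Measure.restrict_univ]
  filter_upwards [Measure.rnDeriv_withDensity lamY hm] with y hy
  rw [h, hy]

/-- The plan that glues the plans `π i` along their common marginal `ξ` on `Y`. -/
noncomputable def glue (π : ∀ i, Measure (X i × Y)) (ξ : Measure Y) : Measure ((∀ i, X i) × Y) :=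
  ((Measure.pi lam).prod lamY).withDensity
    (glueDensity (fun i => (π i).rnDeriv ((lam i).prod lamY)) (ξ.rnDeriv lamY))

variable {π : ∀ i, Measure (X i × Y)} {ξ : Measure Y} [∀ i, IsFiniteMeasure (π i)]
  [IsFiniteMeasure ξ]

lemma map_glue (hac : ∀ i, π i ≪ (lam i).prod lamY) (hξ : ∀ i, (π i).map Prod.snd = ξ)
    (i : Fin N) : (glue lam lamY π ξ).map (pairProj X Y i) = π i := by
  rw [glue, map_withDensity_glueDensity, Measure.withDensity_rnDeriv_eq _ _ (hac i)]
  · exact fun i => Measure.measurable_rnDeriv _ _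
  · exact Measure.measurable_rnDeriv _ _
  · have h := ae_all_iff.2 fun i => ae_lintegral_rnDeriv_eq lamY (lam i) (hac i) (hξ i)
    filter_upwards [h, ξ.rnDeriv_lt_top lamY] with y h1 h2
    exact ⟨h2, h1⟩

lemma glue_univ [NeZero N] (hac : ∀ i, π i ≪ (lam i).prod lamY)
    (hξ : ∀ i, (π i).map Prod.snd = ξ) : glue lam lamY π ξ Set.univ = ξ Set.univ := by
  have h := map_glue lam lamY hac hξ 0
  calc glue lam lamY π ξ Set.univ = (glue lam lamY π ξ).map (pairProj X Y 0) Set.univ := by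
        rw [Measure.map_apply (measurable_pairProj 0) MeasurableSet.univ, Set.preimage_univ]
    _ = (π 0).map Prod.snd Set.univ := by
        rw [h, Measure.map_apply measurable_snd MeasurableSet.univ, Set.preimage_univ]
    _ = ξ Set.univ := by rw [hξ]

lemma map_pi_prod_pairProj (i : Fin N) :
    ((Measure.pi lam).prod lamY).map (pairProj X Y i)
      = (∏ j ∈ Finset.univ.erase i, lam j Set.univ) • (lam i).prod lamY := by
  have h := Measure.map_prod_map (Measure.pi lam) lamY (measurable_pi_apply i) measurable_id
  rw [Measure.map_id] at h
  rw [← Measure.prod_smul_left, ← Measure.pi_map_eval]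
  exact h.symm

lemma entropy_pairProj_ne_top {ρ : Measure ((∀ i, X i) × Y)} [IsFiniteMeasure ρ]
    (h : entropy ((Measure.pi lam).prod lamY) ρ ≠ ⊤) (i : Fin N) :
    entropy ((lam i).prod lamY) (ρ.map (pairProj X Y i)) ≠ ⊤ :=
  entropy_map_ne_top (measurable_pairProj i) (ENNReal.prod_ne_top fun _ _ => measure_ne_top _ _)
    (map_pi_prod_pairProj lam lamY i) h

lemma entropy_snd_ne_top {A : Type*} [MeasurableSpace A] {lamA : Measure A} [IsFiniteMeasure lamA]
    {ρ : Measure (A × Y)} [IsFiniteMeasure ρ] (h : entropy (lamA.prod lamY) ρ ≠ ⊤) :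
    entropy lamY (ρ.map Prod.snd) ≠ ⊤ :=
  entropy_map_ne_top measurable_snd (measure_ne_top lamA Set.univ) Measure.map_snd_prod h

/-- The logarithm of the glued density is the sum of those of the bimarginal densities, minus
`N - 1` times the one of the common marginal. -/
lemma ae_log_glueDensity [NeZero N] {ρ : Measure ((∀ i, X i) × Y)}
    (hρ : ∀ i, ρ.map (pairProj X Y i) = π i) (hρY : ρ.map Prod.snd = ξ)
    (hac : ∀ i, π i ≪ (lam i).prod lamY) (hacY : ξ ≪ lamY) :
    ∀ᵐ z ∂ρ, glueDensity (fun i => (π i).rnDeriv ((lam i).prod lamY)) (ξ.rnDeriv lamY) z ≠ 0 ∧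
      Real.log (glueDensity (fun i => (π i).rnDeriv ((lam i).prod lamY))
          (ξ.rnDeriv lamY) z).toReal
        = ∑ i, llr (π i) ((lam i).prod lamY) (pairProj X Y i z)
          - ((N : ℝ) - 1) * llr ξ lamY z.2 := by
  have h1 : ∀ᵐ z ∂ρ, ∀ i, 0 < (π i).rnDeriv ((lam i).prod lamY) (pairProj X Y i z)
      ∧ (π i).rnDeriv ((lam i).prod lamY) (pairProj X Y i z) < ∞ := by
    refine ae_all_iff.2 fun i => ?_
    refine ae_of_ae_map (f := pairProj X Y i) (p := fun w => 0 < (π i).rnDeriv ((lam i).prod lamY) w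
      ∧ (π i).rnDeriv ((lam i).prod lamY) w < ∞) (measurable_pairProj i).aemeasurable ?_
    rw [hρ i]
    exact (Measure.rnDeriv_pos (hac i)).and ((hac i).ae_le (Measure.rnDeriv_lt_top _ _))
  have h2 : ∀ᵐ z ∂ρ, 0 < ξ.rnDeriv lamY z.2 ∧ ξ.rnDeriv lamY z.2 < ∞ := by
    refine ae_of_ae_map (f := Prod.snd) (p := fun y => 0 < ξ.rnDeriv lamY y
      ∧ ξ.rnDeriv lamY y < ∞) measurable_snd.aemeasurable ?_
    rw [hρY]
    exact (Measure.rnDeriv_pos hacY).and (hacY.ae_le (Measure.rnDeriv_lt_top _ _))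
  filter_upwards [h1, h2] with z h1 h2
  have h3 : ∀ i, ((π i).rnDeriv ((lam i).prod lamY) (pairProj X Y i z)).toReal ≠ 0 :=
    fun i => (ENNReal.toReal_pos (h1 i).1.ne' (h1 i).2.ne).ne'
  have h4 : (ξ.rnDeriv lamY z.2).toReal ≠ 0 := (ENNReal.toReal_pos h2.1.ne' h2.2.ne).ne'
  refine ⟨mul_ne_zero (Finset.prod_ne_zero_iff.2 fun i _ => (h1 i).1.ne')
    (pow_ne_zero _ (ENNReal.inv_ne_zero.2 h2.2.ne)), ?_⟩
  rw [glueDensity, ENNReal.toReal_mul, ENNReal.toReal_prod, ENNReal.toReal_pow,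
    ENNReal.toReal_inv, Real.log_mul (Finset.prod_ne_zero_iff.2 fun i _ => h3 i)
    (pow_ne_zero _ (inv_ne_zero h4)), Real.log_prod fun i _ => h3 i, Real.log_pow, Real.log_inv,
    Nat.cast_sub NeZero.one_le, Nat.cast_one]
  simp only [llr]
  ring

/-- Superadditivity of the entropy with respect to conditioning on `Y`. -/
lemma sum_integral_llr_le [NeZero N] {ρ : Measure ((∀ i, X i) × Y)} [IsFiniteMeasure ρ]
    (hρ : ∀ i, ρ.map (pairProj X Y i) = π i) (hρY : ρ.map Prod.snd = ξ)
    (h : entropy ((Measure.pi lam).prod lamY) ρ ≠ ⊤) :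
    ∑ i, ∫ w, llr (π i) ((lam i).prod lamY) w ∂(π i) - ((N : ℝ) - 1) * ∫ y, llr ξ lamY y ∂ξ
      ≤ ∫ z, llr ρ ((Measure.pi lam).prod lamY) z ∂ρ := by
  have hE : ∀ i, entropy ((lam i).prod lamY) (π i) ≠ ⊤ :=
    fun i => hρ i ▸ entropy_pairProj_ne_top lam lamY h i
  have hEY : entropy lamY ξ ≠ ⊤ := hρY ▸ entropy_snd_ne_top lamY h
  have hξ : ∀ i, (π i).map Prod.snd = ξ := fun i => by rw [← hρ i, map_pairProj_snd, hρY]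
  have hac := fun i => (entropy_ne_top_iff.1 (hE i)).1
  have hlog := ae_log_glueDensity lam lamY hρ hρY hac (entropy_ne_top_iff.1 hEY).1
  have hlog' := hlog.mono fun z hz => hz.2
  obtain ⟨hint, hval⟩ := integrable_sum_llr lam lamY hρ hρY hE hEY
  rw [← hval, ← integral_congr_ae hlog']
  -- Gibbs' inequality against the gluing of the pair marginals of ρ itself, which has the same mass
  -- as ρ.
  refine integral_log_le_integral_llr (measurable_glueDensity
    (fun i => Measure.measurable_rnDeriv _ _) (Measure.measurable_rnDeriv _ _))
    (entropy_ne_top_iff.1 h).1 (entropy_ne_top_iff.1 h).2 ?_ (hlog.mono fun z hz => hz.1)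
    ((integrable_congr hlog').2 hint)
  have := glue_univ lam lamY hac hξ
  rw [glue] at this
  rw [this, ← hρY, Measure.map_apply measurable_snd MeasurableSet.univ, Set.preimage_univ]

/-- The entropy of a glued plan. -/
lemma entropy_glue [NeZero N] (hξ : ∀ i, (π i).map Prod.snd = ξ)
    (hE : ∀ i, entropy ((lam i).prod lamY) (π i) ≠ ⊤) (hEY : entropy lamY ξ ≠ ⊤) :
    entropy ((Measure.pi lam).prod lamY) (glue lam lamY π ξ)
      = ((∑ i, ∫ w, llr (π i) ((lam i).prod lamY) w ∂(π i)
          - ((N : ℝ) - 1) * ∫ y, llr ξ lamY y ∂ξ : ℝ) : EReal) := by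
  have hac := fun i => (entropy_ne_top_iff.1 (hE i)).1
  have hρ := map_glue lam lamY hac hξ
  have hρY : (glue lam lamY π ξ).map Prod.snd = ξ := by
    rw [← map_pairProj_snd _ (0 : Fin N), hρ, hξ]
  have hfin : IsFiniteMeasure (glue lam lamY π ξ) :=
    ⟨glue_univ lam lamY hac hξ ▸ measure_lt_top ξ _⟩
  have hlog := ae_log_glueDensity lam lamY hρ hρY hac (entropy_ne_top_iff.1 hEY).1
  obtain ⟨hint, hval⟩ := integrable_sum_llr lam lamY hρ hρY hE hEY
  have hacG : glue lam lamY π ξ ≪ (Measure.pi lam).prod lamY :=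
    withDensity_absolutelyContinuous _ _
  have hll : llr (glue lam lamY π ξ) ((Measure.pi lam).prod lamY)
      =ᵐ[glue lam lamY π ξ] fun z => ∑ i, llr (π i) ((lam i).prod lamY) (pairProj X Y i z)
          - ((N : ℝ) - 1) * llr ξ lamY z.2 := by
    have h1 := Measure.rnDeriv_withDensity ((Measure.pi lam).prod lamY) (measurable_glueDensity
      (fun i => Measure.measurable_rnDeriv (π i) ((lam i).prod lamY))
      (Measure.measurable_rnDeriv ξ lamY))
    filter_upwards [hlog, hacG.ae_le h1] with z h2 h3
    rw [← h2.2, ← h3]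
    rfl
  rw [entropy_eq_coe (entropy_ne_top_iff.2 ⟨hacG, (integrable_congr hll).2 hint⟩),
    integral_congr_ae hll, hval]

end Glue

/-! ### Extended-real sums and infima. -/

section ERealSums

variable {ι : Type*} (s : Finset ι)

lemma ereal_coe_sum (r : ι → ℝ) : ((∑ i ∈ s, r i : ℝ) : EReal) = ∑ i ∈ s, (r i : EReal) := by
  classical
  induction s using Finset.induction_on with
  | empty => simp
  | insert i s hi ih => rw [Finset.sum_insert hi, Finset.sum_insert hi, EReal.coe_add, ih]

lemma ereal_sum_ne_bot {w : ι → EReal} (h : ∀ i, w i ≠ ⊥) : ∑ i ∈ s, w i ≠ ⊥ := by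
  classical
  induction s using Finset.induction_on with
  | empty => simp
  | insert i s hi ih =>
    rw [Finset.sum_insert hi]
    exact fun h' => (EReal.add_eq_bot_iff.1 h').elim (h i) ih

lemma ereal_sum_eq_top {w : ι → EReal} (h : ∀ i, w i ≠ ⊥) {i : ι} (hi : i ∈ s) (ht : w i = ⊤) :
    ∑ i ∈ s, w i = ⊤ := by
  classical
  rw [← Finset.add_sum_erase _ _ hi, ht]
  exact EReal.top_add_of_ne_bot (ereal_sum_ne_bot _ h)

lemma ereal_coe_mul_iInf {κ : Sort*} {t : ℝ} (ht : 0 < t) (w : κ → EReal) :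
    (t : EReal) * ⨅ k, w k = ⨅ k, (t : EReal) * w k := by
  have ht' : (t : EReal) ≠ 0 := by exact_mod_cast ht.ne'
  refine Monotone.map_iInf_of_continuousAt (f := fun x : EReal => (t : EReal) * x) ?_ ?_ ?_
  · exact (EReal.continuousAt_mul (p := ((t : EReal), ⨅ k, w k)) (Or.inl ht') (Or.inl ht')
      (Or.inl (EReal.coe_ne_bot t)) (Or.inl (EReal.coe_ne_top t))).comp
      (continuousAt_const.prodMk continuousAt_id)
  · exact fun a b hab => mul_le_mul_of_nonneg_left hab (by exact_mod_cast ht.le)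
  · exact EReal.coe_mul_top_of_pos ht

end ERealSums

/-! ### Finite values and scaling of the regularized objective. -/

section Regularized

variable {Z : Type*} [MeasurableSpace Z] {lam : Measure Z} {ε t : ℝ} {c : Z → ℝ}
  {D : Measure Z → ℝ≥0∞}

lemma regObjective_eq_coe_llr {π : Measure Z} (hE : entropy lam π ≠ ⊤) (hD : D π ≠ ∞) :
    regObjective lam ε c D π
      = ((∫ z, c z ∂π + ε * ∫ z, llr π lam z ∂π + (D π).toReal : ℝ) : EReal) := by
  rw [regObjective, entropy_eq_coe hE, ← EReal.coe_ennreal_toReal hD]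
  push_cast
  rfl

/-- Explains the parameter ε / t: after weighting by t, every pair problem has the same entropy
coefficient ε. -/
lemma coe_mul_regObjective (ht : 0 < t) (π : Measure Z) :
    (t : EReal) * regObjective lam (ε / t) c D π
      = regObjective lam ε (fun z => t * c z) (fun ρ => ENNReal.ofReal t * D ρ) π := by
  have ht0 : (0 : EReal) ≤ (t : EReal) := by exact_mod_cast ht.le
  rw [regObjective, regObjective, EReal.left_distrib_of_nonneg_of_ne_top ht0 (EReal.coe_ne_top t),
    EReal.left_distrib_of_nonneg_of_ne_top ht0 (EReal.coe_ne_top t), ← mul_assoc,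
    ← EReal.coe_mul, ← EReal.coe_mul, mul_div_cancel₀ _ ht.ne', integral_const_mul,
    EReal.coe_ennreal_mul, EReal.coe_ennreal_ofReal, max_eq_left ht.le]

variable [IsFiniteMeasure lam]

lemma entropy_ne_top_of_regObjective (hε : 0 < ε) {π : Measure Z} [IsFiniteMeasure π]
    (h : regObjective lam ε c D π ≠ ⊤) : entropy lam π ≠ ⊤ :=
  entropy_ne_top_iff_klDiv.2 (klDiv_ne_top_of_convexPart hε ((regObjective_ne_top_iff hε π).1 h))

lemma penalty_ne_top_of_regObjective (hε : 0 < ε) {π : Measure Z} [IsFiniteMeasure π]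
    (h : regObjective lam ε c D π ≠ ⊤) : D π ≠ ∞ :=
  (ENNReal.add_ne_top.1 ((regObjective_ne_top_iff hε π).1 h)).2

end Regularized

/-! ### The weighted bimarginal problems. -/

section BimarginalTerms

variable {X Y : Type*} [MeasurableSpace X] [MeasurableSpace Y] {lamX : Measure X}
  {lamY : Measure Y} {ε t C : ℝ} {c : X × Y → ℝ}
  {φ : ℝ → ℝ≥0∞} {μ : FiniteMeasure X} {ξ : FiniteMeasure Y}

/-- The objective of the weighted bimarginal problem without the constraint on `Y`. -/
noncomputable def pairObjective (lamX : Measure X) (lamY : Measure Y) (ε t : ℝ) (c : X × Y → ℝ)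
    (φ : ℝ → ℝ≥0∞) (μ : FiniteMeasure X) (π : Measure (X × Y)) : EReal :=
  regObjective (lamX.prod lamY) ε (fun w => t * c w)
    (fun ρ => phiDiv (fun x => ENNReal.ofReal t * φ x) (ρ.map Prod.fst) (μ : Measure X)) π

-- One formula for all weights: at t = 0 the scaled cost and penalty vanish, which matches the
-- convention for that case, and a factor t > 0 leaves the 0/∞ constraint unchanged. The constraint
-- term is constant in the penalty's argument, which is harmless as the penalty is only evaluated at
-- π.
open Classical in
lemma weightedUOT_eq_iInf (ht : 0 ≤ t) :
    weightedUOT lamX lamY ε t c φ (convexIndicator {1}) μ ξ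
      = ⨅ π : FiniteMeasure (X × Y), regObjective (lamX.prod lamY) ε (fun w => t * c w)
        (fun ρ => phiDiv (fun x => ENNReal.ofReal t * φ x) (ρ.map Prod.fst) (μ : Measure X)
          + if (π : Measure (X × Y)).map Prod.snd = (ξ : Measure Y) then 0 else ∞)
        (π : Measure (X × Y)) := by
  have hobj : ∀ (ε' : ℝ) (c' : X × Y → ℝ) (φ' : ℝ → ℝ≥0∞) (π : FiniteMeasure (X × Y)),
      uotObjective lamX lamY ε' c' φ' (convexIndicator {1}) μ ξ π
        = regObjective (lamX.prod lamY) ε' c'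
          (fun ρ => phiDiv φ' (ρ.map Prod.fst) (μ : Measure X)
            + if (π : Measure (X × Y)).map Prod.snd = (ξ : Measure Y) then 0 else ∞)
          (π : Measure (X × Y)) := by
    intro ε' c' φ' π
    rw [uotObjective, phiDiv_convexIndicator_one, regObjective]
  rcases ht.eq_or_lt with rfl | ht
  · rw [weightedUOT, if_pos rfl, UOT]
    refine iInf_congr fun π => ?_
    rw [hobj]
    have h0 : ∀ ρ : Measure X, phiDiv (fun _ => 0) ρ (μ : Measure X) = 0 := fun ρ => by
      simpa using phiDiv_const_mul (φ := φ) ENNReal.zero_ne_top ρ (μ : Measure X)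
    simp only [regObjective, phiDiv_convexIndicator_Ici, h0, ENNReal.ofReal_zero, zero_mul]
  · rw [weightedUOT, if_neg ht.ne', UOT, ereal_coe_mul_iInf ht]
    refine iInf_congr fun π => ?_
    rw [hobj, coe_mul_regObjective ht]
    simp only [regObjective, phiDiv_const_mul ENNReal.ofReal_ne_top]
    split_ifs
    · simp
    · rw [add_top, add_top, ENNReal.mul_top (by simpa using ht)]

lemma weightedUOT_le (ht : 0 ≤ t) {π : FiniteMeasure (X × Y)}
    (hπ : (π : Measure (X × Y)).map Prod.snd = (ξ : Measure Y)) :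
    weightedUOT lamX lamY ε t c φ (convexIndicator {1}) μ ξ
      ≤ pairObjective lamX lamY ε t c φ μ (π : Measure (X × Y)) := by
  rw [weightedUOT_eq_iInf ht]
  refine (iInf_le _ π).trans_eq ?_
  rw [pairObjective, regObjective, regObjective, if_pos hπ, add_zero]

variable [IsFiniteMeasure lamX] [IsFiniteMeasure lamY]

lemma exists_pairObjective_lt (hε : 0 < ε) (ht : 0 ≤ t) {a : EReal}
    (h : weightedUOT lamX lamY ε t c φ (convexIndicator {1}) μ ξ < a) :
    ∃ π : FiniteMeasure (X × Y), (π : Measure (X × Y)).map Prod.snd = (ξ : Measure Y) ∧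
      pairObjective lamX lamY ε t c φ μ (π : Measure (X × Y)) < a := by
  rw [weightedUOT_eq_iInf ht, iInf_lt_iff] at h
  obtain ⟨π, hπ⟩ := h
  have hsnd : (π : Measure (X × Y)).map Prod.snd = (ξ : Measure Y) := by
    by_contra hne
    have := penalty_ne_top_of_regObjective hε hπ.ne_top
    simp [hne] at this
  refine ⟨π, hsnd, lt_of_eq_of_lt ?_ hπ⟩
  rw [pairObjective, regObjective, regObjective, if_pos hsnd, add_zero]

/-- The entropic lower bound is uniform in the plan. Excluding ⊥ makes a sum of such terms ⊤ as soon
as one of them is. -/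
lemma weightedUOT_ne_bot (hε : 0 < ε) (ht : 0 ≤ t) (hC : ∀ w, |c w| ≤ C) :
    weightedUOT lamX lamY ε t c φ (convexIndicator {1}) μ ξ ≠ ⊥ := by
  classical
  have hC' : ∀ w, |t * c w| ≤ t * C := fun w => by
    rw [abs_mul, abs_of_nonneg ht]
    exact mul_le_mul_of_nonneg_left (hC w) ht
  rw [weightedUOT_eq_iInf ht]
  exact ne_bot_of_le_ne_bot (EReal.coe_ne_bot _)
    (le_iInf fun π => coe_le_regObjective hε hC' (π : Measure (X × Y)))

end BimarginalTerms

/-! ### Comparison of the two functionals. -/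

section MultiMarginal

lemma abs_starCost_le {N : ℕ} {X : Fin N → Type*} {Y : Type*} {t C : Fin N → ℝ}
    {c : ∀ i, X i × Y → ℝ} (hC : ∀ i w, |c i w| ≤ C i) (z : (∀ i, X i) × Y) :
    |starCost t c z| ≤ ∑ i, |t i| * C i :=
  (Finset.abs_sum_le_sum_abs _ _).trans (Finset.sum_le_sum fun i _ => by
    rw [abs_mul]
    exact mul_le_mul_of_nonneg_left (hC i _) (abs_nonneg _))

variable {N : ℕ} {X : Fin N → Type*} {Y : Type*} [∀ i, MeasurableSpace (X i)] [MeasurableSpace Y]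
  {lam : ∀ i, Measure (X i)} {lamY : Measure Y} {ε : ℝ} {t C : Fin N → ℝ} {c : ∀ i, X i × Y → ℝ}
  {φ : Fin N → ℝ → ℝ≥0∞} {μ : ∀ i, FiniteMeasure (X i)} {μY : FiniteMeasure Y}

/-- The penalty of the multi-marginal problem. -/
noncomputable def multiPenalty (t : Fin N → ℝ) (φ : Fin N → ℝ → ℝ≥0∞)
    (μ : ∀ i, FiniteMeasure (X i)) (ρ : Measure ((∀ i, X i) × Y)) : ℝ≥0∞ :=
  ∑ i, phiDiv (fun x => ENNReal.ofReal (t i) * φ i x) (ρ.map fun z => z.1 i)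
    (μ i : Measure (X i))

lemma isConvexLSC_multiPenalty (hφ : ∀ i, IsEntropyFunction (φ i)) :
    IsConvexLSC (multiPenalty (Y := Y) t φ μ) := by
  refine IsConvexLSC.sum _ fun i => ?_
  simp only [phiDiv_const_mul ENNReal.ofReal_ne_top]
  exact ((isConvexLSC_phiDiv (hφ i) _).const_mul ENNReal.ofReal_ne_top).comp_map (by fun_prop)

lemma umotObjective_eq (π : FiniteMeasure ((∀ i, X i) × Y)) :
    umotObjective lam lamY ε (starCost t c) (fun i x => ENNReal.ofReal (t i) * φ i x)
        (convexIndicator (Set.Ici 0)) μ μY π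
      = regObjective ((Measure.pi lam).prod lamY) ε (starCost t c) (multiPenalty t φ μ)
        (π : Measure ((∀ i, X i) × Y)) := by
  rw [umotObjective, phiDiv_convexIndicator_Ici, add_zero, regObjective, multiPenalty]

lemma measurable_starCost (hc : ∀ i, Measurable (c i)) : Measurable (starCost t c) :=
  Finset.measurable_sum _ fun i _ => ((hc i).comp (measurable_pairProj i)).const_mul (t i)

lemma integral_starCost (hc : ∀ i, Measurable (c i)) (hC : ∀ i w, |c i w| ≤ C i)
    (ρ : Measure ((∀ i, X i) × Y)) [IsFiniteMeasure ρ] :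
    ∫ z, starCost t c z ∂ρ = ∑ i, ∫ w, t i * c i w ∂(ρ.map (pairProj X Y i)) := by
  have hint : ∀ i, Integrable (fun z => t i * c i (pairProj X Y i z)) ρ := fun i =>
    (integrable_of_abs_le ((hc i).comp (measurable_pairProj i)) (fun z => hC i _) ρ).const_mul _
  have h := integral_finsetSum Finset.univ (fun i _ => hint i)
  refine h.trans (Finset.sum_congr rfl fun i _ => ?_)
  rw [integral_map (measurable_pairProj i).aemeasurable
    ((hc i).const_mul (t i)).aestronglyMeasurable]

lemma multiPenalty_eq (ρ : Measure ((∀ i, X i) × Y)) :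
    multiPenalty t φ μ ρ = ∑ i, phiDiv (fun x => ENNReal.ofReal (t i) * φ i x)
      ((ρ.map (pairProj X Y i)).map Prod.fst) (μ i : Measure (X i)) := by
  simp only [multiPenalty, map_pairProj_fst]

variable [∀ i, IsFiniteMeasure (lam i)] [IsFiniteMeasure lamY]

/-- The value of the barycenter functional at the marginal of a plan is at most the value of the
plan. -/
lemma baryObjective_le (hε : 0 < ε) [NeZero N] (ht : ∀ i, 0 ≤ t i) (hc : ∀ i, Measurable (c i))
    (hC : ∀ i w, |c i w| ≤ C i) (π : FiniteMeasure ((∀ i, X i) × Y)) :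
    baryObjective lam lamY ε t c φ μ (π.map Prod.snd)
      ≤ regObjective ((Measure.pi lam).prod lamY) ε (starCost t c) (multiPenalty t φ μ)
        (π : Measure ((∀ i, X i) × Y)) := by
  by_cases htop : regObjective ((Measure.pi lam).prod lamY) ε (starCost t c) (multiPenalty t φ μ)
        (π : Measure ((∀ i, X i) × Y)) = ⊤
  · rw [htop]
    exact le_top
  have hE := entropy_ne_top_of_regObjective hε htop
  have hP := penalty_ne_top_of_regObjective hε htop
  have hEY := entropy_snd_ne_top lamY hE
  have hEi := entropy_pairProj_ne_top lam lamY hE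
  set ρ : Measure ((∀ i, X i) × Y) := (π : Measure ((∀ i, X i) × Y)) with hρ
  have hPi : ∀ i, phiDiv (fun x => ENNReal.ofReal (t i) * φ i x)
      ((ρ.map (pairProj X Y i)).map Prod.fst) (μ i : Measure (X i)) ≠ ∞ := fun i => by
    rw [multiPenalty_eq] at hP
    exact ENNReal.sum_ne_top.1 hP i (Finset.mem_univ i)
  have hw : ∀ i, weightedUOT (lam i) lamY ε (t i) (c i) (φ i) (convexIndicator {1}) (μ i)
      (π.map Prod.snd) ≤ _ := fun i =>
    (weightedUOT_le (ht i) (ξ := π.map Prod.snd) (π := π.map (pairProj X Y i)) (map_pairProj_snd ρ i)).trans_eq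
      (regObjective_eq_coe_llr (hEi i) (hPi i))
  have hsup := sum_integral_llr_le lam lamY (fun i => rfl) rfl hE
  have hent : entropy lamY ((π.map Prod.snd : FiniteMeasure Y) : Measure Y)
      = ((∫ y, llr (ρ.map Prod.snd) lamY y ∂(ρ.map Prod.snd) : ℝ) : EReal) := entropy_eq_coe hEY
  rw [baryObjective, if_neg (by rw [hent]; exact EReal.coe_ne_top _), hent,
    regObjective_eq_coe_llr hE hP]
  refine (EReal.sub_le_sub (Finset.sum_le_sum fun i _ => hw i) le_rfl).trans ?_
  rw [← ereal_coe_sum, ← EReal.coe_mul, ← EReal.coe_sub, EReal.coe_le_coe_iff,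
    integral_starCost hc hC ρ, multiPenalty_eq, ENNReal.toReal_sum fun i _ => hPi i]
  have := mul_le_mul_of_nonneg_left hsup hε.le
  simp only [FiniteMeasure.toMeasure_map, ← hρ, Finset.sum_add_distrib, ← Finset.mul_sum]
  linarith

/-- Near-optimal bimarginal plans can be glued to a plan with at most the same value. -/
lemma exists_regObjective_lt (hε : 0 < ε) [NeZero N] (ht : ∀ i, 0 ≤ t i)
    (hc : ∀ i, Measurable (c i)) (hC : ∀ i w, |c i w| ≤ C i) {ξ : FiniteMeasure Y} {a : EReal}
    (h : baryObjective lam lamY ε t c φ μ ξ < a) :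
    ∃ π : FiniteMeasure ((∀ i, X i) × Y),
      (π : Measure ((∀ i, X i) × Y)).map Prod.snd = (ξ : Measure Y) ∧
      regObjective ((Measure.pi lam).prod lamY) ε (starCost t c) (multiPenalty t φ μ)
        (π : Measure ((∀ i, X i) × Y)) < a := by
  have hEY : entropy lamY (ξ : Measure Y) ≠ ⊤ := by
    intro h'
    rw [baryObjective, if_pos h'] at h
    exact not_top_lt h
  set w : Fin N → EReal := fun i =>
    weightedUOT (lam i) lamY ε (t i) (c i) (φ i) (convexIndicator {1}) (μ i) ξ with hw
  set e : ℝ := ε * ((N : ℝ) - 1) * ∫ y, llr (ξ : Measure Y) lamY y ∂(ξ : Measure Y) with he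
  have hF : baryObjective lam lamY ε t c φ μ ξ = ∑ i, w i - (e : EReal) := by
    rw [baryObjective, if_neg hEY, entropy_eq_coe hEY, ← EReal.coe_mul]
  have hbot : ∀ i, w i ≠ ⊥ := fun i => weightedUOT_ne_bot hε (ht i) (hC i)
  have htop : ∀ i, w i ≠ ⊤ := by
    intro i hi
    rw [hF, ereal_sum_eq_top _ hbot (Finset.mem_univ i) hi, EReal.top_sub_coe] at h
    exact not_top_lt h
  have hr : ∀ i, w i = ((w i).toReal : EReal) := fun i => (EReal.coe_toReal (htop i) (hbot i)).symm
  rw [hF, Finset.sum_congr rfl fun i _ => hr i, ← ereal_coe_sum, ← EReal.coe_sub] at h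
  obtain ⟨s, hs, hsa⟩ := EReal.lt_iff_exists_real_btwn.1 h
  rw [EReal.coe_lt_coe_iff] at hs
  have hN : (0 : ℝ) < N := by exact_mod_cast Nat.pos_of_ne_zero (NeZero.ne N)
  -- The gap up to s is shared equally among the N pair problems.
  set η : ℝ := (s - (∑ i, (w i).toReal - e)) / N with hη
  have hηpos : 0 < η := div_pos (by linarith) hN
  have hex : ∀ i, ∃ π : FiniteMeasure (X i × Y),
      (π : Measure (X i × Y)).map Prod.snd = (ξ : Measure Y) ∧
      pairObjective (lam i) lamY ε (t i) (c i) (φ i) (μ i) (π : Measure (X i × Y))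
        < (((w i).toReal + η : ℝ) : EReal) := by
    intro i
    refine exists_pairObjective_lt hε (ht i) ?_
    change w i < _
    rw [hr i]
    exact_mod_cast lt_add_of_pos_right _ hηpos
  choose π hπ hlt using hex
  have hE : ∀ i, entropy ((lam i).prod lamY) (π i : Measure (X i × Y)) ≠ ⊤ :=
    fun i => entropy_ne_top_of_regObjective hε (hlt i).ne_top
  have hP : ∀ i, phiDiv (fun x => ENNReal.ofReal (t i) * φ i x)
      ((π i : Measure (X i × Y)).map Prod.fst) (μ i : Measure (X i)) ≠ ∞ :=
    fun i => penalty_ne_top_of_regObjective (D := fun ρ => phiDiv _ (ρ.map Prod.fst) _) hε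
      (hlt i).ne_top
  have hac := fun i => (entropy_ne_top_iff.1 (hE i)).1
  have hmap := map_glue lam lamY hac hπ
  set ρ := glue lam lamY (fun i => (π i : Measure (X i × Y))) (ξ : Measure Y) with hρ
  have hfin : IsFiniteMeasure ρ := ⟨glue_univ lam lamY hac hπ ▸ measure_lt_top (ξ : Measure Y) _⟩
  have hent := entropy_glue lam lamY hπ hE hEY
  have hPm : multiPenalty t φ μ ρ ≠ ∞ := by
    rw [multiPenalty_eq]
    refine ENNReal.sum_ne_top.2 fun i _ => ?_
    rw [hmap i]
    exact hP i
  set v : Fin N → ℝ := fun i => ∫ w, t i * c i w ∂(π i : Measure (X i × Y))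
      + ε * ∫ w, llr (π i : Measure (X i × Y)) ((lam i).prod lamY) w ∂(π i : Measure (X i × Y))
      + (phiDiv (fun x => ENNReal.ofReal (t i) * φ i x)
          ((π i : Measure (X i × Y)).map Prod.fst) (μ i : Measure (X i))).toReal with hv
  have hval : regObjective ((Measure.pi lam).prod lamY) ε (starCost t c) (multiPenalty t φ μ) ρ
      = ((∑ i, v i - e : ℝ) : EReal) := by
    rw [regObjective, hent, ← EReal.coe_ennreal_toReal hPm, integral_starCost hc hC ρ,
      multiPenalty_eq, ← EReal.coe_mul, ← EReal.coe_add, ← EReal.coe_add]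
    congr 1
    simp only [hmap]
    rw [ENNReal.toReal_sum fun i _ => hP i]
    simp only [hv, Finset.sum_add_distrib, ← Finset.mul_sum]
    rw [he]
    ring
  have hvs : ∑ i, v i - e < s := by
    have h1 : ∀ i, v i < (w i).toReal + η := fun i => by
      have := hlt i
      rwa [pairObjective, regObjective_eq_coe_llr (hE i) (hP i), EReal.coe_lt_coe_iff] at this
    have h2 := Finset.sum_lt_sum_of_nonempty (s := Finset.univ) Finset.univ_nonempty
      fun i _ => h1 i
    rw [Finset.sum_add_distrib (f := fun i => (w i).toReal) (g := fun _ => η), Finset.sum_const, Finset.card_univ,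
      Fintype.card_fin, nsmul_eq_mul, hη, mul_div_cancel₀ _ hN.ne'] at h2
    linarith
  refine ⟨⟨ρ, hfin⟩, ?_, lt_of_eq_of_lt hval ((EReal.coe_lt_coe_iff.2 hvs).trans hsa)⟩
  exact (map_pairProj_snd ρ 0).symm.trans (by rw [hmap 0, hπ 0])

end MultiMarginal

end UnbalancedOT

/-! ### The main theorem. -/

theorem mainTheorem3 {N : ℕ} {X : Fin N → Type*} {Y : Type*}
    [∀ i, TopologicalSpace (X i)] [∀ i, CompactSpace (X i)] [∀ i, PolishSpace (X i)]
    [∀ i, MeasurableSpace (X i)] [∀ i, BorelSpace (X i)]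
    [TopologicalSpace Y] [CompactSpace Y] [PolishSpace Y] [MeasurableSpace Y] [BorelSpace Y]
    (lam : ∀ i, Measure (X i)) [∀ i, IsFiniteMeasure (lam i)]
    (lamY : Measure Y) [IsFiniteMeasure lamY]
    (ε : ℝ) (hε : 0 < ε)
    (t : Fin N → ℝ) (ht : t ∈ stdSimplex ℝ (Fin N))
    (c : ∀ i, X i × Y → ℝ) (hc : ∀ i, Continuous (c i))
    (φ : Fin N → ℝ → ℝ≥0∞) (hφ : ∀ i, UnbalancedOT.IsEntropyFunction (φ i))
    (μ : ∀ i, FiniteMeasure (X i)) (μY : FiniteMeasure Y)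
    (hpos : 0 < (∑ i, (UnbalancedOT.recession (φ i) : EReal))
      + ⨅ z : (∀ i, X i) × Y, (UnbalancedOT.starCost t c z : EReal)) :
    (⨅ ξ : FiniteMeasure Y, UnbalancedOT.baryObjective lam lamY ε t c φ μ ξ)
        = UnbalancedOT.UMOT lam lamY ε (UnbalancedOT.starCost t c)
            (fun i x => ENNReal.ofReal (t i) * φ i x)
            (UnbalancedOT.convexIndicator (Set.Ici 0)) μ μY
    ∧ (UnbalancedOT.UMOT lam lamY ε (UnbalancedOT.starCost t c)
            (fun i x => ENNReal.ofReal (t i) * φ i x)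
            (UnbalancedOT.convexIndicator (Set.Ici 0)) μ μY < ⊤ →
        ∃ (πhat : FiniteMeasure ((∀ i, X i) × Y)) (ξhat : FiniteMeasure Y),
          (∀ π : FiniteMeasure ((∀ i, X i) × Y),
            IsMinOn (UnbalancedOT.umotObjective lam lamY ε (UnbalancedOT.starCost t c)
              (fun i x => ENNReal.ofReal (t i) * φ i x)
              (UnbalancedOT.convexIndicator (Set.Ici 0)) μ μY) Set.univ π ↔ π = πhat)
          ∧ (∀ ξ : FiniteMeasure Y,
            IsMinOn (UnbalancedOT.baryObjective lam lamY ε t c φ μ) Set.univ ξ ↔ ξ = ξhat)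
          ∧ πhat.map Prod.snd = ξhat) := by
  have hN : NeZero N := ⟨by
    rintro rfl
    simpa using ht.2⟩
  have hcm : ∀ i, Measurable (c i) := fun i => (hc i).measurable
  have hcb : ∀ i, ∃ C : ℝ, ∀ w, |c i w| ≤ C := fun i => by
    obtain ⟨C, hC⟩ := isCompact_univ.exists_bound_of_continuousOn (hc i).continuousOn
    exact ⟨C, fun w => hC w (Set.mem_univ w)⟩
  choose C hC using hcb
  set J := UnbalancedOT.umotObjective lam lamY ε (UnbalancedOT.starCost t c)
    (fun i x => ENNReal.ofReal (t i) * φ i x)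
    (UnbalancedOT.convexIndicator (Set.Ici 0)) μ μY with hJdef
  set F := UnbalancedOT.baryObjective lam lamY ε t c φ μ with hFdef
  have hJ : ∀ π, J π = UnbalancedOT.regObjective ((Measure.pi lam).prod lamY) ε
      (UnbalancedOT.starCost t c) (UnbalancedOT.multiPenalty t φ μ)
      (π : Measure ((∀ i, X i) × Y)) := UnbalancedOT.umotObjective_eq
  have hFJ : ∀ π, F (π.map Prod.snd) ≤ J π := fun π => by
    rw [hJ]
    exact UnbalancedOT.baryObjective_le hε ht.1 hcm hC π
  have hJF : ∀ ξ a, F ξ < a → ∃ π : FiniteMeasure ((∀ i, X i) × Y),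
      (π : Measure ((∀ i, X i) × Y)).map Prod.snd = (ξ : Measure Y) ∧ J π < a := fun ξ a h => by
    simp only [hJ]
    exact UnbalancedOT.exists_regObjective_lt hε ht.1 hcm hC h
  have heq : ⨅ ξ, F ξ = ⨅ π, J π := by
    refine le_antisymm (le_iInf fun π => (iInf_le _ _).trans (hFJ π)) (le_iInf fun ξ => ?_)
    refine le_of_forall_gt_imp_ge_of_dense fun a ha => ?_
    obtain ⟨π, -, hπ⟩ := hJF ξ a ha
    exact (iInf_le _ π).trans hπ.le
  refine ⟨heq, fun hlt => ?_⟩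
  obtain ⟨π₀, hπ₀⟩ := iInf_lt_iff.1 hlt
  change J π₀ < ⊤ at hπ₀
  obtain ⟨ρ, hρ, hρtop, hρmin, hρstab⟩ := UnbalancedOT.exists_minimizer
    (lam := (Measure.pi lam).prod lamY) hε (UnbalancedOT.measurable_starCost hcm)
    (UnbalancedOT.abs_starCost_le hC)
    (UnbalancedOT.isConvexLSC_multiPenalty (Y := Y) (t := t) (μ := μ) hφ)
    ⟨π₀, inferInstance, hJ π₀ ▸ hπ₀.ne⟩
  set πhat : FiniteMeasure ((∀ i, X i) × Y) := ⟨ρ, hρ⟩ with hπhat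
  have hJhat : J πhat = UnbalancedOT.regObjective ((Measure.pi lam).prod lamY) ε
      (UnbalancedOT.starCost t c) (UnbalancedOT.multiPenalty t φ μ) ρ := hJ πhat
  have hmin : ∀ π, J πhat ≤ J π := fun π => by
    rw [hJhat, hJ]
    exact hρmin _
  have hbot : J πhat ≠ ⊥ := hJhat ▸ UnbalancedOT.regObjective_ne_bot hε ρ
  have htop : J πhat ≠ ⊤ := hJhat ▸ hρtop
  have hadd : ∀ η : ℝ, 0 < η → J πhat < J πhat + (η : EReal) := fun η hη => by
    rw [← EReal.coe_toReal htop hbot]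
    exact_mod_cast lt_add_of_pos_right _ hη
  -- A number that plans arbitrarily close to optimal assign to A must be the mass of A under the
  -- optimal plan.
  have hstab : ∀ (A : Set ((∀ i, X i) × Y)) (r : ℝ),
      (∀ η : ℝ, 0 < η → ∃ π : FiniteMeasure ((∀ i, X i) × Y), J π ≤ J πhat + (η : EReal) ∧
        (π : Measure ((∀ i, X i) × Y)).real A = r) → r = ρ.real A := by
    intro A r h
    refine eq_of_abs_sub_nonpos (le_of_forall_gt_imp_ge_of_dense fun τ hτ => ?_)
    obtain ⟨η, hη, hη'⟩ := hρstab τ hτ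
    obtain ⟨π, hπ, rfl⟩ := h η hη
    refine hη' _ ?_ A
    rwa [hJ, hJhat] at hπ
  refine ⟨πhat, πhat.map Prod.snd, fun π => ⟨fun hπ => ?_, ?_⟩, fun ξ => ⟨fun hξ => ?_, ?_⟩, rfl⟩
  · suffices h : (π : Measure ((∀ i, X i) × Y)) = ρ from Subtype.ext h
    refine Measure.ext fun A _ => ?_
    have h := hstab A ((π : Measure ((∀ i, X i) × Y)).real A) fun η hη =>
      ⟨π, (hπ (Set.mem_univ πhat)).trans (hadd η hη).le, rfl⟩
    exact (measureReal_eq_measureReal_iff (measure_ne_top _ _) (measure_ne_top _ _)).1 h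
  · rintro rfl π' -
    exact hmin π'
  · suffices h : (ξ : Measure Y) = ρ.map Prod.snd from Subtype.ext h
    refine Measure.ext fun B hB => ?_
    -- Near-optimal gluings over ξ suffice: each gives `Prod.snd ⁻¹' B` the mass ξ(B).
    have h := hstab (Prod.snd ⁻¹' B) ((ξ : Measure Y).real B) fun η hη => by
      obtain ⟨π, hπ, hlt⟩ := hJF ξ (J πhat + (η : EReal))
        (((hξ (Set.mem_univ (πhat.map Prod.snd))).trans (hFJ πhat)).trans_lt (hadd η hη))
      refine ⟨π, hlt.le, ?_⟩
      rw [← hπ, map_measureReal_apply measurable_snd hB]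
    have h2 := (measureReal_eq_measureReal_iff (measure_ne_top _ _) (measure_ne_top _ _)).1 h
    exact h2.trans (Measure.map_apply measurable_snd hB).symm
  · rintro rfl ξ' -
    refine (hFJ πhat).trans ?_
    have h1 : J πhat ≤ ⨅ ξ, F ξ := heq ▸ le_iInf hmin
    exact h1.trans (iInf_le _ ξ')
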